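/- **Setting.** Let $\mathfrak H=\mathfrak H_1\oplus\mathfrak H_2$ be an orthogonal sum of complex Hilbert spaces and let $$T^\circ=\begin{pmatrix}T_{11}^\circ&T_{12}^\circ\\ T_{21}^\circ&T_{22}^\circ\end{pmatrix}$$ be a symmetric (densely defined) operator matrix with domain $\operatorname{dom}T_{11}^\circ\oplus\operatorname{dom}T_{22}^\circ$, where $T_{11}^\circ,T_{21}^\circ$ are defined on $\operatorname{dom}T_{11}^\circ\subseteq\mathfrak H_1$ and $T_{12}^\circ,T_{22}^\circ$ on $\operatorname{dom}T_{22}^\circ\subseteq\mathfrak H_2$. Let $\varkappa,\tau\in\mathbb R$ satisfy $\langle(T_{11}^\circ-\varkappa)y,y\rangle\ge\|y\|^2$ for all $y\in\operatorname{dom}T_{11}^\circ$ and $\langle(\tau-T_{22}^\circ)y,y\rangle\ge\|y\|^2$ for all $y\in\operatorname{dom}T_{22}^\circ$. Let $\mathfrak D_2$ be the completion of $\operatorname{dom}T_{22}^\circ$ in the norm $\langle(\tau-T_{22}^\circ)y,y\rangle^{1/2}$, let $I_2\colon\mathfrak D_2\to\mathfrak H_2$ be the embedding and $T_{22}^\bullet$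 the corresponding Friedrichs extension of $T_{22}^\circ$. Let $\mathfrak D_1$ be the completion of $\operatorname{dom}T_{11}^\circ$ in the norm $$\bigl[\langle(T_{11}^\circ-\varkappa)y,y\rangle+\langle(\tau-T_{22}^\bullet)^{-1}T_{21}^\circ y,T_{21}^\circ y\rangle\bigr]^{1/2},$$ with embedding $I_1\colon\mathfrak D_1\to\mathfrak H_1$. Put $\mathfrak D=\mathfrak D_1\oplus\mathfrak D_2$, $I=I_1\oplus I_2$; let $\mathfrak D_i^*$, $\mathfrak D^*$ be the spaces of bounded antilinear functionals and $I_i^*\colon\mathfrak H_i\to\mathfrak D_i^*$, $I^*\colon\mathfrak H\to\mathfrak D^*$ the adjoint embeddings. The operators $y\mapsto I_i^*T_{ij}^\circ y$ extend by continuity to bounded operators $T_{ij}\colon\mathfrak D_j\to\mathfrak D_i^*$, which form a bounded operator $T\colon\mathfrak D\to\mathfrak D^*$. The operator $T^\bullet=(I^*)^{-1}TI^{-1}$ in $\mathfrak H$ is called the angular extension of $T^\circ$; likewise $T_{22}^\bullet=(I_2^*)^{-1}T_{22}I_2^{-1}$. For $\lambda$ in the resolvent set $\varrho(T_{22}^\bullet)$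 put $$S(\lambda)=T_{11}-\lambda I_1^*I_1-T_{12}\,[T_{22}-\lambda I_2^*I_2]^{-1}\,T_{21}\colon\ \mathfrak D_1\to\mathfrak D_1^*.$$ A bounded operator $P\colon\mathfrak D_1\to\mathfrak D_1^*$ is uniformly positive (uniformly negative) if for some $\varepsilon>0$ one has $\langle Py,y\rangle\ge\varepsilon\|y\|_{\mathfrak D_1}^2$ (respectively $\langle Py,y\rangle\le-\varepsilon\|y\|_{\mathfrak D_1}^2$) for all $y\in\mathfrak D_1$. A compact perturbation of $P$ is an operator $P+K$ with $K\colon\mathfrak D_1\to\mathfrak D_1^*$ compact. **Theorem.** Let $\zeta^-\le\zeta^+$ be real numbers with $[\zeta^-,\zeta^+]\subseteq\varrho(T_{22}^\bullet)$, and suppose that every point of the spectrum of $T^\bullet$ in $[\zeta^-,\zeta^+]$ is an isolated point of the spectrum of $T^\bullet$ and an eigenvalue of finite multiplicity. 1. If $S(\zeta^-)$ is a compact perturbation of some uniformly positive operator, then so is $S(\zeta^+)$. 2. If $S(\zeta^+)$ is a compact perturbation of some uniformly negative operator, then so is $S(\zeta^-)$. -/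

import Mathlib

open scoped InnerProductSpace ComplexConjugate

set_option linter.unusedSectionVars false

noncomputable section

namespace BlockOp

/-! ### Unbounded operators in a Hilbert space: resolvent set, spectrum, eigenvalues -/

section Unbounded

variable {H : Type*} [NormedAddCommGroup H] [InnerProductSpace ℂ H]

/-- `R` is the everywhere defined bounded inverse `(A - z)⁻¹` of the operator `A - z`. -/
def IsResolventAt (A : H →ₗ.[ℂ] H) (z : ℂ) (R : H →L[ℂ] H) : Prop :=
  (∀ h : H, ∃ hx : R h ∈ A.domain, A ⟨R h, hx⟩ - z • R h = h) ∧
    ∀ x : A.domain, R (A x - z • (x : H)) = x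

/-- The resolvent set of an unbounded operator. -/
def resolventSet (A : H →ₗ.[ℂ] H) : Set ℂ := {z | ∃ R : H →L[ℂ] H, IsResolventAt A z R}

/-- The spectrum of an unbounded operator. -/
def spectrum (A : H →ₗ.[ℂ] H) : Set ℂ := (resolventSet A)ᶜ

/-- The kernel of `A - z`, as a subspace of `H`. -/
def eigenspace (A : H →ₗ.[ℂ] H) (z : ℂ) : Submodule ℂ H :=
  A.graph.comap (LinearMap.prod LinearMap.id (z • LinearMap.id))

/-- `z` is an isolated point of the spectrum of `A` and an eigenvalue of finite multiplicity. -/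
def IsIsolatedFiniteEigenvalue (A : H →ₗ.[ℂ] H) (z : ℂ) : Prop :=
  z ∈ spectrum A ∧ (∃ r > 0, ∀ w ∈ spectrum A, dist w z < r → w = z) ∧
    eigenspace A z ≠ ⊥ ∧ FiniteDimensional ℂ (eigenspace A z)

end Unbounded

/-! ### Antidual spaces and operators in a rigging `D → H → D*` -/

section Rigging

variable {H D E : Type*} [NormedAddCommGroup H] [InnerProductSpace ℂ H]
  [NormedAddCommGroup D] [InnerProductSpace ℂ D] [NormedAddCommGroup E] [InnerProductSpace ℂ E]

/-- The dual space `E*` of a Hilbert space: bounded antilinear functionals, so that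
`⟨f, z⟩ = f z` is linear in `f` and antilinear in `z`. -/
abbrev AntiDual (E : Type*) [NormedAddCommGroup E] [InnerProductSpace ℂ E] : Type _ := E →L⋆[ℂ] ℂ

/-- The transposed operator `E* → D*` of a bounded operator `f : D → E`. -/
def antidualMap (f : D →L[ℂ] E) : AntiDual E →L[ℂ] AntiDual D :=
  LinearMap.mkContinuous
    { toFun := fun φ => φ.comp f
      map_add' := fun _ _ => rfl
      map_smul' := fun _ _ => rfl } ‖f‖
    fun φ => (mul_comm ‖φ‖ ‖f‖) ▸ φ.opNorm_comp_le f

@[simp] lemma antidualMap_apply (f : D →L[ℂ] E) (φ : AntiDual E) (z : D) :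
    antidualMap f φ z = φ (f z) := rfl

/-- The operator `I* : H → D*` for a bounded operator `I : D → H`
(`H` being identified with its own antidual): `⟨I* h, z⟩ = ⟨h, I z⟩`. -/
def rigDual (I : D →L[ℂ] H) : H →L[ℂ] AntiDual D := antidualMap I ∘L innerSLFlip ℂ

@[simp] lemma rigDual_apply (I : D →L[ℂ] H) (h : H) (z : D) :
    rigDual I h z = ⟪I z, h⟫_ℂ := rfl

/-- The graph `{(I y, h) : T y = I* h}` of the operator `(I*)⁻¹ T I⁻¹`. -/
def bulletGraph (I : D →L[ℂ] H) (T : D →L[ℂ] AntiDual D) : Submodule ℂ (H × H) where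
  carrier := {p | ∃ y : D, I y = p.1 ∧ T y = rigDual I p.2}
  zero_mem' := ⟨0, by simp, by simp⟩
  add_mem' := by
    rintro p q ⟨y, hy, hy'⟩ ⟨z, hz, hz'⟩
    exact ⟨y + z, by simp [hy, hz], by simp only [map_add, hy', hz', Prod.snd_add]⟩
  smul_mem' := by
    rintro c p ⟨y, hy, hy'⟩
    exact ⟨c • y, by simp [hy], by simp only [map_smul, hy', Prod.smul_snd]⟩

/-- The (unbounded) operator `T^• = (I*)⁻¹ T I⁻¹` in `H`. -/
def bullet (I : D →L[ℂ] H) (T : D →L[ℂ] AntiDual D) : H →ₗ.[ℂ] H :=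
  (bulletGraph I T).toLinearPMap

lemma graph_bullet {I : D →L[ℂ] H} (hinj : Function.Injective I) (hdense : DenseRange I)
    (T : D →L[ℂ] AntiDual D) : (bullet I T).graph = bulletGraph I T := by
  apply Submodule.toLinearPMap_graph_eq
  rintro ⟨x, h⟩ ⟨y, hy, hy'⟩ hx
  simp only at hx hy hy' ⊢
  have : y = 0 := hinj (by rw [hy, hx, map_zero])
  subst this
  refine hdense.eq_zero_of_inner_right ℂ fun z => ?_
  have := DFunLike.congr_fun hy' z
  simpa using this.symm

/-- `⟨P y, y⟩ ≥ ε ‖y‖²` for some `ε > 0` and all `y`. -/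
def IsUniformlyPositive (P : D →L[ℂ] AntiDual D) : Prop :=
  ∃ ε : ℝ, 0 < ε ∧ ∀ y : D, (P y y).im = 0 ∧ ε * ‖y‖ ^ 2 ≤ (P y y).re

/-- `⟨P y, y⟩ ≤ -ε ‖y‖²` for some `ε > 0` and all `y`. -/
def IsUniformlyNegative (P : D →L[ℂ] AntiDual D) : Prop :=
  ∃ ε : ℝ, 0 < ε ∧ ∀ y : D, (P y y).im = 0 ∧ (P y y).re ≤ -(ε * ‖y‖ ^ 2)

/-- A compact perturbation of some uniformly positive operator. -/
def IsCompactPerturbationOfPositive (S : D →L[ℂ] AntiDual D) : Prop :=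
  ∃ P K : D →L[ℂ] AntiDual D, IsUniformlyPositive P ∧ IsCompactOperator K ∧ S = P + K

/-- A compact perturbation of some uniformly negative operator. -/
def IsCompactPerturbationOfNegative (S : D →L[ℂ] AntiDual D) : Prop :=
  ∃ P K : D →L[ℂ] AntiDual D, IsUniformlyNegative P ∧ IsCompactOperator K ∧ S = P + K

end Rigging

/-! ### Symmetric operator matrices -/

/-- A symmetric (in particular densely defined) operator matrix with entries
`T₁₁ : dom T₁₁ → H₁`, `T₁₂ : dom T₂₂ → H₁`, `T₂₁ : dom T₁₁ → H₂`, `T₂₂ : dom T₂₂ → H₂`,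
together with numbers `κ`, `τ` such that `T₁₁ - κ ≥ 1` and `τ - T₂₂ ≥ 1`. -/
structure BlockMatrix (H₁ H₂ : Type*) [NormedAddCommGroup H₁] [InnerProductSpace ℂ H₁]
    [NormedAddCommGroup H₂] [InnerProductSpace ℂ H₂] where
  T₁₁ : H₁ →ₗ.[ℂ] H₁
  T₂₂ : H₂ →ₗ.[ℂ] H₂
  T₁₂ : T₂₂.domain →ₗ[ℂ] H₁
  T₂₁ : T₁₁.domain →ₗ[ℂ] H₂
  dense₁ : Dense (T₁₁.domain : Set H₁)
  dense₂ : Dense (T₂₂.domain : Set H₂)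
  symm₁₁ : ∀ x y : T₁₁.domain, ⟪T₁₁ x, (y : H₁)⟫_ℂ = ⟪(x : H₁), T₁₁ y⟫_ℂ
  symm₂₂ : ∀ x y : T₂₂.domain, ⟪T₂₂ x, (y : H₂)⟫_ℂ = ⟪(x : H₂), T₂₂ y⟫_ℂ
  symm₂₁ : ∀ (x : T₁₁.domain) (y : T₂₂.domain), ⟪T₂₁ x, (y : H₂)⟫_ℂ = ⟪(x : H₁), T₁₂ y⟫_ℂ
  κ : ℝ
  τ : ℝ
  bound₁ : ∀ y : T₁₁.domain, ‖(y : H₁)‖ ^ 2 ≤ (⟪(y : H₁), T₁₁ y - (κ : ℂ) • (y : H₁)⟫_ℂ).re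
  bound₂ : ∀ y : T₂₂.domain, ‖(y : H₂)‖ ^ 2 ≤ (⟪(y : H₂), (τ : ℂ) • (y : H₂) - T₂₂ y⟫_ℂ).re

namespace BlockMatrix

variable {H₁ H₂ : Type*} [NormedAddCommGroup H₁] [InnerProductSpace ℂ H₁]
  [NormedAddCommGroup H₂] [InnerProductSpace ℂ H₂]

/-! #### The space `D₂` and the Friedrichs extension of `T₂₂` -/

/-- `dom T₂₂` with the inner product `⟨(τ - T₂₂) y, z⟩`. -/
def PreD₂ (M : BlockMatrix H₁ H₂) : Type _ := M.T₂₂.domain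

instance (M : BlockMatrix H₁ H₂) : AddCommGroup M.PreD₂ :=
  inferInstanceAs (AddCommGroup M.T₂₂.domain)

instance (M : BlockMatrix H₁ H₂) : Module ℂ M.PreD₂ :=
  inferInstanceAs (Module ℂ M.T₂₂.domain)

/-- The inclusion of `dom T₂₂` into `H₂`. -/
def incl₂ (M : BlockMatrix H₁ H₂) : M.PreD₂ →ₗ[ℂ] H₂ := M.T₂₂.domain.subtype

/-- `T₂₂` as a linear map on `dom T₂₂`. -/
def op₂₂ (M : BlockMatrix H₁ H₂) : M.PreD₂ →ₗ[ℂ] H₂ := M.T₂₂.toFun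

/-- `T₁₂` as a linear map on `dom T₂₂`. -/
def op₁₂ (M : BlockMatrix H₁ H₂) : M.PreD₂ →ₗ[ℂ] H₁ := M.T₁₂

lemma op₂₂_symm (M : BlockMatrix H₁ H₂) (x y : M.PreD₂) :
    ⟪M.op₂₂ x, M.incl₂ y⟫_ℂ = ⟪M.incl₂ x, M.op₂₂ y⟫_ℂ := M.symm₂₂ x y

instance core₂ (M : BlockMatrix H₁ H₂) : InnerProductSpace.Core ℂ M.PreD₂ where
  inner y z := ⟪M.incl₂ y, (M.τ : ℂ) • M.incl₂ z - M.op₂₂ z⟫_ℂ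
  conj_inner_symm x y := by
    simp only [inner_sub_right, inner_smul_right, map_sub, map_mul, inner_conj_symm,
      Complex.conj_ofReal, op₂₂_symm]
  re_inner_nonneg x := (sq_nonneg _).trans (M.bound₂ x)
  add_left x y z := by simp only [map_add, inner_add_left]
  smul_left x y r := by simp only [map_smul, inner_smul_left]
  definite x hx := by
    have h := M.bound₂ x
    have h0 : (⟪M.incl₂ x, (M.τ : ℂ) • M.incl₂ x - M.op₂₂ x⟫_ℂ).re = 0 := by
      rw [hx]; rfl
    have h1 : ‖M.incl₂ x‖ ^ 2 ≤ 0 := h0 ▸ h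
    have h2 : M.incl₂ x = 0 := by
      simpa using le_antisymm h1 (sq_nonneg _)
    exact Subtype.ext h2

instance (M : BlockMatrix H₁ H₂) : NormedAddCommGroup M.PreD₂ :=
  InnerProductSpace.Core.toNormedAddCommGroup (𝕜 := ℂ)

instance (M : BlockMatrix H₁ H₂) : InnerProductSpace ℂ M.PreD₂ := .ofCore M.core₂.toCore

lemma inner_preD₂ (M : BlockMatrix H₁ H₂) (y z : M.PreD₂) :
    ⟪y, z⟫_ℂ = ⟪M.incl₂ y, (M.τ : ℂ) • M.incl₂ z - M.op₂₂ z⟫_ℂ := rfl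

lemma norm_incl₂_le (M : BlockMatrix H₁ H₂) (y : M.PreD₂) : ‖M.incl₂ y‖ ≤ ‖y‖ := by
  have h := M.bound₂ y
  refine le_of_sq_le_sq ?_ (norm_nonneg _)
  rw [← inner_self_eq_norm_sq (𝕜 := ℂ) y]
  exact h

/-- The completion of `dom T₂₂` in the norm `⟨(τ - T₂₂) y, y⟩^{1/2}`. -/
abbrev D₂ (M : BlockMatrix H₁ H₂) : Type _ := UniformSpace.Completion M.PreD₂

/-- The canonical embedding of `dom T₂₂` into `D₂`. -/
abbrev ι₂ (M : BlockMatrix H₁ H₂) : M.PreD₂ →L[ℂ] M.D₂ := UniformSpace.Completion.toComplL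

lemma denseRange_ι₂ (M : BlockMatrix H₁ H₂) : DenseRange M.ι₂ :=
  UniformSpace.Completion.denseRange_coe

lemma norm_ι₂ (M : BlockMatrix H₁ H₂) (y : M.PreD₂) : ‖M.ι₂ y‖ = ‖y‖ :=
  UniformSpace.Completion.norm_coe y

lemma inner_ι₂ (M : BlockMatrix H₁ H₂) (y z : M.PreD₂) : ⟪M.ι₂ y, M.ι₂ z⟫_ℂ = ⟪y, z⟫_ℂ :=
  UniformSpace.Completion.inner_coe y z

section

variable [CompleteSpace H₂]

/-- The embedding `I₂ : D₂ → H₂`: the continuous extension of the inclusion. -/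
def I₂ (M : BlockMatrix H₁ H₂) : M.D₂ →L[ℂ] H₂ :=
  M.incl₂.extendOfNorm M.ι₂.toLinearMap

lemma I₂_ι₂ (M : BlockMatrix H₁ H₂) (y : M.PreD₂) : M.I₂ (M.ι₂ y) = M.incl₂ y :=
  LinearMap.extendOfNorm_eq (e := M.ι₂.toLinearMap) M.denseRange_ι₂
    ⟨1, fun x => by simpa [M.norm_ι₂] using M.norm_incl₂_le x⟩ y

lemma denseRange_I₂ (M : BlockMatrix H₁ H₂) : DenseRange M.I₂ := by
  refine M.dense₂.mono ?_
  intro x hx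
  exact ⟨M.ι₂ (⟨x, hx⟩ : M.T₂₂.domain), M.I₂_ι₂ _⟩

lemma inner_ι₂_eq (M : BlockMatrix H₁ H₂) (y : M.PreD₂) (z : M.D₂) :
    ⟪z, M.ι₂ y⟫_ℂ = ⟪M.I₂ z, (M.τ : ℂ) • M.incl₂ y - M.op₂₂ y⟫_ℂ := by
  refine M.denseRange_ι₂.induction_on z (isClosed_eq (by fun_prop) (by fun_prop)) fun x => ?_
  rw [inner_ι₂, inner_preD₂, I₂_ι₂]

lemma injective_I₂ (M : BlockMatrix H₁ H₂) : Function.Injective M.I₂ := by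
  refine (injective_iff_map_eq_zero M.I₂).2 fun z hz => ?_
  refine M.denseRange_ι₂.eq_zero_of_inner_left ℂ fun y => ?_
  rw [inner_ι₂_eq, hz, inner_zero_left]

lemma rigDual_op₂₂ (M : BlockMatrix H₁ H₂) (y : M.PreD₂) :
    rigDual M.I₂ (M.op₂₂ y) =
      (M.τ : ℂ) • rigDual M.I₂ (M.I₂ (M.ι₂ y)) - innerSLFlip ℂ (M.ι₂ y) := by
  ext z
  simp only [rigDual_apply, sub_apply, smul_apply,
    innerSLFlip_apply_apply, inner_ι₂_eq, I₂_ι₂, inner_sub_right, inner_smul_right, smul_eq_mul]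
  ring

/-- The operator `T₂₂ : D₂ → D₂*`: the continuous extension of `y ↦ I₂* T₂₂ y`. -/
def A₂₂ (M : BlockMatrix H₁ H₂) : M.D₂ →L[ℂ] AntiDual M.D₂ :=
  ((rigDual M.I₂).toLinearMap ∘ₗ M.op₂₂).extendOfNorm M.ι₂.toLinearMap

lemma A₂₂_eq (M : BlockMatrix H₁ H₂) :
    M.A₂₂ = (M.τ : ℂ) • (rigDual M.I₂ ∘L M.I₂) - innerSLFlip ℂ := by
  set B : M.D₂ →L[ℂ] AntiDual M.D₂ := (M.τ : ℂ) • (rigDual M.I₂ ∘L M.I₂) - innerSLFlip ℂ with hB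
  have key : ∀ y, B (M.ι₂ y) = rigDual M.I₂ (M.op₂₂ y) := fun y => by
    rw [rigDual_op₂₂, hB]; rfl
  refine LinearMap.extendOfNorm_unique (e := M.ι₂.toLinearMap) M.denseRange_ι₂ ‖B‖ (fun y => ?_) B ?_
  · have := B.le_opNorm (M.ι₂ y)
    rw [key] at this
    exact this
  · ext1 y
    exact key y

lemma A₂₂_ι₂ (M : BlockMatrix H₁ H₂) (y : M.PreD₂) :
    M.A₂₂ (M.ι₂ y) = rigDual M.I₂ (M.op₂₂ y) := by
  rw [A₂₂_eq, rigDual_op₂₂]; rfl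

/-- The Friedrichs extension `T₂₂^• = (I₂*)⁻¹ T₂₂ I₂⁻¹`. -/
def friedrichs (M : BlockMatrix H₁ H₂) : H₂ →ₗ.[ℂ] H₂ := bullet M.I₂ M.A₂₂

lemma graph_friedrichs (M : BlockMatrix H₁ H₂) :
    M.friedrichs.graph = bulletGraph M.I₂ M.A₂₂ :=
  graph_bullet M.injective_I₂ M.denseRange_I₂ _

/-- The bounded operator `(τ - T₂₂^•)⁻¹` in `H₂`; see `isResolventAt_friedrichs`. -/
def resolvent₂ (M : BlockMatrix H₁ H₂) : H₂ →L[ℂ] H₂ :=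
  M.I₂ ∘L ContinuousLinearMap.adjoint M.I₂

/-- `resolvent₂` is the inverse of `τ - T₂₂^•`. -/
lemma isResolventAt_friedrichs (M : BlockMatrix H₁ H₂) :
    IsResolventAt M.friedrichs M.τ (-M.resolvent₂) := by
  have hadj : ∀ h : H₂, (innerSLFlip ℂ (ContinuousLinearMap.adjoint M.I₂ h) : AntiDual M.D₂) =
      rigDual M.I₂ h := fun h => by
    ext z
    simp [ContinuousLinearMap.adjoint_inner_right]
  constructor
  · intro h
    have hg : ((-M.resolvent₂) h, h + (M.τ : ℂ) • (-M.resolvent₂) h) ∈ M.friedrichs.graph := by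
      rw [graph_friedrichs]
      refine ⟨-(ContinuousLinearMap.adjoint M.I₂ h), by simp [resolvent₂], ?_⟩
      rw [A₂₂_eq, map_add, map_smul, ← hadj h]
      simp [resolvent₂, add_comm]
    obtain ⟨x, hx1, hx2⟩ := LinearPMap.mem_graph_iff _ |>.1 hg
    simp only at hx1 hx2
    have hx : (-M.resolvent₂) h ∈ M.friedrichs.domain := hx1 ▸ x.2
    refine ⟨hx, ?_⟩
    have : x = ⟨_, hx⟩ := Subtype.ext hx1
    rw [← this, hx2, add_sub_cancel_right]
  · intro x
    have hg := M.friedrichs.mem_graph x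
    rw [graph_friedrichs] at hg
    obtain ⟨y, hy, hy'⟩ := hg
    simp only at hy hy'
    have h1 : ContinuousLinearMap.adjoint M.I₂ (M.friedrichs x - (M.τ : ℂ) • (x : H₂)) = -y := by
      refine ext_inner_left ℂ fun z => ?_
      have h2 := DFunLike.congr_fun hy' z
      rw [A₂₂_eq] at h2
      simp only [sub_apply, smul_apply,
        ContinuousLinearMap.comp_apply, rigDual_apply, innerSLFlip_apply_apply, smul_eq_mul] at h2
      rw [ContinuousLinearMap.adjoint_inner_right, inner_sub_right, ← h2, ← hy, inner_smul_right,
        inner_neg_right]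
      ring
    simp only [resolvent₂, neg_apply, ContinuousLinearMap.comp_apply, h1,
      map_neg, neg_neg, hy]

lemma inner_resolvent₂ (M : BlockMatrix H₁ H₂) (u v : H₂) :
    ⟪u, M.resolvent₂ v⟫_ℂ =
      ⟪ContinuousLinearMap.adjoint M.I₂ u, ContinuousLinearMap.adjoint M.I₂ v⟫_ℂ := by
  rw [ContinuousLinearMap.adjoint_inner_left]; rfl

end

/-! #### The space `D₁` -/

section

variable [CompleteSpace H₁] [CompleteSpace H₂]

/-- `dom T₁₁` with the inner product
`⟨(T₁₁ - κ) y, z⟩ + ⟨(τ - T₂₂^•)⁻¹ T₂₁ y, T₂₁ z⟩`. -/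
def PreD₁ (M : BlockMatrix H₁ H₂) : Type _ := M.T₁₁.domain

instance (M : BlockMatrix H₁ H₂) : AddCommGroup M.PreD₁ :=
  inferInstanceAs (AddCommGroup M.T₁₁.domain)

instance (M : BlockMatrix H₁ H₂) : Module ℂ M.PreD₁ :=
  inferInstanceAs (Module ℂ M.T₁₁.domain)

/-- The inclusion of `dom T₁₁` into `H₁`. -/
def incl₁ (M : BlockMatrix H₁ H₂) : M.PreD₁ →ₗ[ℂ] H₁ := M.T₁₁.domain.subtype

/-- `T₁₁` as a linear map on `dom T₁₁`. -/
def op₁₁ (M : BlockMatrix H₁ H₂) : M.PreD₁ →ₗ[ℂ] H₁ := M.T₁₁.toFun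

/-- `T₂₁` as a linear map on `dom T₁₁`. -/
def op₂₁ (M : BlockMatrix H₁ H₂) : M.PreD₁ →ₗ[ℂ] H₂ := M.T₂₁

lemma op₁₁_symm (M : BlockMatrix H₁ H₂) (x y : M.PreD₁) :
    ⟪M.op₁₁ x, M.incl₁ y⟫_ℂ = ⟪M.incl₁ x, M.op₁₁ y⟫_ℂ := M.symm₁₁ x y

lemma op₂₁_op₁₂ (M : BlockMatrix H₁ H₂) (x : M.PreD₁) (y : M.PreD₂) :
    ⟪M.op₂₁ x, M.incl₂ y⟫_ℂ = ⟪M.incl₁ x, M.op₁₂ y⟫_ℂ := M.symm₂₁ x y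

lemma re_inner_resolvent₂ (M : BlockMatrix H₁ H₂) (u : H₂) :
    (⟪u, M.resolvent₂ u⟫_ℂ).re = ‖ContinuousLinearMap.adjoint M.I₂ u‖ ^ 2 := by
  rw [inner_resolvent₂]
  exact inner_self_eq_norm_sq (𝕜 := ℂ) _

instance core₁ (M : BlockMatrix H₁ H₂) : InnerProductSpace.Core ℂ M.PreD₁ where
  inner y z := ⟪M.incl₁ y, M.op₁₁ z - (M.κ : ℂ) • M.incl₁ z⟫_ℂ +
    ⟪M.op₂₁ y, M.resolvent₂ (M.op₂₁ z)⟫_ℂ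
  conj_inner_symm x y := by
    simp only [inner_sub_right, inner_smul_right, map_sub, map_add, map_mul, inner_conj_symm,
      Complex.conj_ofReal, op₁₁_symm, inner_resolvent₂]
  re_inner_nonneg x := by
    have h1 := (sq_nonneg _).trans (M.bound₁ x)
    have h2 := (sq_nonneg _).trans_eq (M.re_inner_resolvent₂ (M.op₂₁ x)).symm
    exact add_nonneg h1 h2
  add_left x y z := by simp only [map_add, inner_add_left]; ring
  smul_left x y r := by simp only [map_smul, inner_smul_left]; ring
  definite x hx := by
    have h := M.bound₁ x
    have h2 := (sq_nonneg _).trans_eq (M.re_inner_resolvent₂ (M.op₂₁ x)).symm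
    have h0 := congrArg Complex.re hx
    rw [Complex.add_re, Complex.zero_re] at h0
    have h1 : ‖M.incl₁ x‖ ^ 2 ≤ 0 := by
      refine h.trans ?_
      have : (⟪M.incl₁ x, M.op₁₁ x - (M.κ : ℂ) • M.incl₁ x⟫_ℂ).re ≤ 0 := by linarith
      exact this
    have h2 : M.incl₁ x = 0 := by
      simpa using le_antisymm h1 (sq_nonneg _)
    exact Subtype.ext h2

instance (M : BlockMatrix H₁ H₂) : NormedAddCommGroup M.PreD₁ :=
  InnerProductSpace.Core.toNormedAddCommGroup (𝕜 := ℂ)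

instance (M : BlockMatrix H₁ H₂) : InnerProductSpace ℂ M.PreD₁ := .ofCore M.core₁.toCore

lemma inner_preD₁ (M : BlockMatrix H₁ H₂) (y z : M.PreD₁) :
    ⟪y, z⟫_ℂ = ⟪M.incl₁ y, M.op₁₁ z - (M.κ : ℂ) • M.incl₁ z⟫_ℂ +
      ⟪M.op₂₁ y, M.resolvent₂ (M.op₂₁ z)⟫_ℂ := rfl

lemma norm_sq_preD₁ (M : BlockMatrix H₁ H₂) (y : M.PreD₁) :
    ‖y‖ ^ 2 = (⟪M.incl₁ y, M.op₁₁ y - (M.κ : ℂ) • M.incl₁ y⟫_ℂ).re +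
      ‖ContinuousLinearMap.adjoint M.I₂ (M.op₂₁ y)‖ ^ 2 := by
  rw [← M.re_inner_resolvent₂, ← Complex.add_re, ← inner_preD₁]
  exact (inner_self_eq_norm_sq (𝕜 := ℂ) y).symm

lemma norm_incl₁_le (M : BlockMatrix H₁ H₂) (y : M.PreD₁) : ‖M.incl₁ y‖ ≤ ‖y‖ := by
  have h : ‖M.incl₁ y‖ ^ 2 ≤ _ := M.bound₁ y
  refine le_of_sq_le_sq ?_ (norm_nonneg _)
  rw [norm_sq_preD₁]
  exact h.trans (le_add_of_nonneg_right (sq_nonneg _))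

lemma norm_adjoint_op₂₁_le (M : BlockMatrix H₁ H₂) (y : M.PreD₁) :
    ‖ContinuousLinearMap.adjoint M.I₂ (M.op₂₁ y)‖ ≤ ‖y‖ := by
  have h := (sq_nonneg _).trans (M.bound₁ y)
  refine le_of_sq_le_sq ?_ (norm_nonneg _)
  rw [norm_sq_preD₁]
  exact le_add_of_nonneg_left h

/-- The completion of `dom T₁₁` in the norm of `PreD₁`. -/
abbrev D₁ (M : BlockMatrix H₁ H₂) : Type _ := UniformSpace.Completion M.PreD₁

/-- The canonical embedding of `dom T₁₁` into `D₁`. -/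
abbrev ι₁ (M : BlockMatrix H₁ H₂) : M.PreD₁ →L[ℂ] M.D₁ := UniformSpace.Completion.toComplL

lemma denseRange_ι₁ (M : BlockMatrix H₁ H₂) : DenseRange M.ι₁ :=
  UniformSpace.Completion.denseRange_coe

lemma norm_ι₁ (M : BlockMatrix H₁ H₂) (y : M.PreD₁) : ‖M.ι₁ y‖ = ‖y‖ :=
  UniformSpace.Completion.norm_coe y

lemma inner_ι₁ (M : BlockMatrix H₁ H₂) (y z : M.PreD₁) : ⟪M.ι₁ y, M.ι₁ z⟫_ℂ = ⟪y, z⟫_ℂ :=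
  UniformSpace.Completion.inner_coe y z

/-- The embedding `I₁ : D₁ → H₁`: the continuous extension of the inclusion. -/
def I₁ (M : BlockMatrix H₁ H₂) : M.D₁ →L[ℂ] H₁ :=
  M.incl₁.extendOfNorm M.ι₁.toLinearMap

lemma I₁_ι₁ (M : BlockMatrix H₁ H₂) (y : M.PreD₁) : M.I₁ (M.ι₁ y) = M.incl₁ y :=
  LinearMap.extendOfNorm_eq (e := M.ι₁.toLinearMap) M.denseRange_ι₁
    ⟨1, fun x => by simpa [M.norm_ι₁] using M.norm_incl₁_le x⟩ y

lemma denseRange_I₁ (M : BlockMatrix H₁ H₂) : DenseRange M.I₁ := by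
  refine M.dense₁.mono ?_
  intro x hx
  exact ⟨M.ι₁ (⟨x, hx⟩ : M.T₁₁.domain), M.I₁_ι₁ _⟩

/-! #### The bounded entries of the extended operator matrix -/

/-- The operator `T₂₁ : D₁ → D₂*`: the continuous extension of `y ↦ I₂* T₂₁ y`. -/
def A₂₁ (M : BlockMatrix H₁ H₂) : M.D₁ →L[ℂ] AntiDual M.D₂ :=
  ((rigDual M.I₂).toLinearMap ∘ₗ M.op₂₁).extendOfNorm M.ι₁.toLinearMap

lemma A₂₁_ι₁ (M : BlockMatrix H₁ H₂) (y : M.PreD₁) :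
    M.A₂₁ (M.ι₁ y) = rigDual M.I₂ (M.op₂₁ y) := by
  refine LinearMap.extendOfNorm_eq (e := M.ι₁.toLinearMap) M.denseRange_ι₁ ⟨1, fun x => ?_⟩ y
  change ‖rigDual M.I₂ (M.op₂₁ x)‖ ≤ 1 * ‖M.ι₁ x‖
  rw [norm_ι₁, one_mul]
  refine ContinuousLinearMap.opNorm_le_bound _ (norm_nonneg _) fun z => ?_
  rw [rigDual_apply, ← ContinuousLinearMap.adjoint_inner_right, mul_comm]
  exact (norm_inner_le_norm _ _).trans (by gcongr; exact M.norm_adjoint_op₂₁_le x)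

/-- The operator `T₁₂ : D₂ → D₁*`: the continuous extension of `y ↦ I₁* T₁₂ y`. -/
def A₁₂ (M : BlockMatrix H₁ H₂) : M.D₂ →L[ℂ] AntiDual M.D₁ :=
  ((rigDual M.I₁).toLinearMap ∘ₗ M.op₁₂).extendOfNorm M.ι₂.toLinearMap

lemma A₁₂_ι₂ (M : BlockMatrix H₁ H₂) (y : M.PreD₂) :
    M.A₁₂ (M.ι₂ y) = rigDual M.I₁ (M.op₁₂ y) := by
  refine LinearMap.extendOfNorm_eq (e := M.ι₂.toLinearMap) M.denseRange_ι₂ ⟨1, fun x => ?_⟩ y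
  change ‖rigDual M.I₁ (M.op₁₂ x)‖ ≤ 1 * ‖M.ι₂ x‖
  rw [one_mul]
  refine ContinuousLinearMap.opNorm_le_bound _ (norm_nonneg _) fun z => ?_
  refine M.denseRange_ι₁.induction_on z (isClosed_le (by fun_prop) (by fun_prop)) fun w => ?_
  rw [rigDual_apply, I₁_ι₁, ← op₂₁_op₁₂, ← I₂_ι₂, ← ContinuousLinearMap.adjoint_inner_left,
    mul_comm, norm_ι₁]
  exact (norm_inner_le_norm _ _).trans (by gcongr; exact M.norm_adjoint_op₂₁_le w)

/-- The operator `T₁₁ : D₁ → D₁*`: the continuous extension of `y ↦ I₁* T₁₁ y`. -/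
def A₁₁ (M : BlockMatrix H₁ H₂) : M.D₁ →L[ℂ] AntiDual M.D₁ :=
  ((rigDual M.I₁).toLinearMap ∘ₗ M.op₁₁).extendOfNorm M.ι₁.toLinearMap

lemma A₁₁_ι₁ (M : BlockMatrix H₁ H₂) (y : M.PreD₁) :
    M.A₁₁ (M.ι₁ y) = rigDual M.I₁ (M.op₁₁ y) := by
  refine LinearMap.extendOfNorm_eq (e := M.ι₁.toLinearMap) M.denseRange_ι₁ ⟨2 + |M.κ|, fun x => ?_⟩ y
  change ‖rigDual M.I₁ (M.op₁₁ x)‖ ≤ (2 + |M.κ|) * ‖M.ι₁ x‖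
  rw [norm_ι₁]
  refine ContinuousLinearMap.opNorm_le_bound _ (by positivity) fun z => ?_
  refine M.denseRange_ι₁.induction_on z (isClosed_le (by fun_prop) (by fun_prop)) fun w => ?_
  have h : ⟪M.incl₁ w, M.op₁₁ x⟫_ℂ = ⟪w, x⟫_ℂ -
      ⟪ContinuousLinearMap.adjoint M.I₂ (M.op₂₁ w), ContinuousLinearMap.adjoint M.I₂ (M.op₂₁ x)⟫_ℂ +
      (M.κ : ℂ) * ⟪M.incl₁ w, M.incl₁ x⟫_ℂ := by
    rw [inner_preD₁, inner_resolvent₂, inner_sub_right, inner_smul_right]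
    ring
  rw [rigDual_apply, I₁_ι₁, norm_ι₁, h]
  have h1 := norm_inner_le_norm (𝕜 := ℂ) w x
  have h2 : ‖⟪ContinuousLinearMap.adjoint M.I₂ (M.op₂₁ w),
      ContinuousLinearMap.adjoint M.I₂ (M.op₂₁ x)⟫_ℂ‖ ≤ ‖w‖ * ‖x‖ :=
    (norm_inner_le_norm _ _).trans
      (mul_le_mul (M.norm_adjoint_op₂₁_le w) (M.norm_adjoint_op₂₁_le x) (norm_nonneg _)
        (norm_nonneg _))
  have h3 : ‖(M.κ : ℂ) * ⟪M.incl₁ w, M.incl₁ x⟫_ℂ‖ ≤ |M.κ| * (‖w‖ * ‖x‖) := by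
    rw [norm_mul, Complex.norm_real, Real.norm_eq_abs]
    gcongr
    exact (norm_inner_le_norm _ _).trans
      (mul_le_mul (M.norm_incl₁_le w) (M.norm_incl₁_le x) (norm_nonneg _) (norm_nonneg _))
  calc _ ≤ ‖w‖ * ‖x‖ + ‖w‖ * ‖x‖ + |M.κ| * (‖w‖ * ‖x‖) :=
        (norm_add_le _ _).trans (add_le_add ((norm_sub_le _ _).trans (add_le_add h1 h2)) h3)
    _ = _ := by ring

lemma injective_I₁ (M : BlockMatrix H₁ H₂) : Function.Injective M.I₁ := by
  refine (injective_iff_map_eq_zero M.I₁).2 fun z hz => ?_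
  have h21 : ∀ (z : M.D₁) (w : M.PreD₂), M.A₂₁ z (M.ι₂ w) = conj ⟪M.I₁ z, M.op₁₂ w⟫_ℂ := by
    intro z w
    refine M.denseRange_ι₁.induction_on z (isClosed_eq (by fun_prop) ?_) fun x => ?_
    · exact Complex.continuous_conj.comp (by fun_prop)
    · rw [A₂₁_ι₁, rigDual_apply, I₂_ι₂, I₁_ι₁, ← op₂₁_op₁₂, inner_conj_symm]
  have hA : M.A₂₁ z = 0 := by
    ext d
    refine M.denseRange_ι₂.induction_on d (isClosed_eq (by fun_prop) (by fun_prop)) fun w => ?_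
    rw [h21, hz, inner_zero_left, map_zero]; rfl
  have hin : ∀ (z : M.D₁) (w : M.PreD₁), ⟪M.ι₁ w, z⟫_ℂ =
      ⟪M.op₁₁ w - (M.κ : ℂ) • M.incl₁ w, M.I₁ z⟫_ℂ +
        M.A₂₁ z (ContinuousLinearMap.adjoint M.I₂ (M.op₂₁ w)) := by
    intro z w
    refine M.denseRange_ι₁.induction_on z (isClosed_eq (by fun_prop) (by fun_prop)) fun x => ?_
    rw [inner_ι₁, inner_preD₁, inner_resolvent₂, A₂₁_ι₁, rigDual_apply,
      ContinuousLinearMap.adjoint_inner_right, I₁_ι₁]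
    simp only [inner_sub_left, inner_sub_right, inner_smul_left, inner_smul_right,
      Complex.conj_ofReal, op₁₁_symm]
  refine M.denseRange_ι₁.eq_zero_of_inner_right ℂ fun w => ?_
  rw [hin, hz, hA, inner_zero_right, zero_apply, add_zero]

/-! #### The angular extension and the transfer operator function -/

/-- The Hilbert space `H = H₁ ⊕ H₂`. -/
abbrev Hsum (_ : BlockMatrix H₁ H₂) : Type _ := WithLp 2 (H₁ × H₂)

/-- The Hilbert space `D = D₁ ⊕ D₂`. -/
abbrev D (M : BlockMatrix H₁ H₂) : Type _ := WithLp 2 (M.D₁ × M.D₂)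

/-- The embedding `I = I₁ ⊕ I₂ : D → H`. -/
def I (M : BlockMatrix H₁ H₂) : M.D →L[ℂ] M.Hsum :=
  (WithLp.prodContinuousLinearEquiv 2 ℂ H₁ H₂).symm.toContinuousLinearMap ∘L
    (M.I₁.prodMap M.I₂) ∘L
      (WithLp.prodContinuousLinearEquiv 2 ℂ M.D₁ M.D₂).toContinuousLinearMap

/-- The bounded operator `T : D → D*` with the entries `T₁₁`, `T₁₂`, `T₂₁`, `T₂₂`
(here `D* = D₁* ⊕ D₂*`). -/
def A (M : BlockMatrix H₁ H₂) : M.D →L[ℂ] AntiDual M.D :=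
  antidualMap (WithLp.fstL 2 ℂ M.D₁ M.D₂) ∘L
      (M.A₁₁ ∘L WithLp.fstL 2 ℂ M.D₁ M.D₂ + M.A₁₂ ∘L WithLp.sndL 2 ℂ M.D₁ M.D₂) +
    antidualMap (WithLp.sndL 2 ℂ M.D₁ M.D₂) ∘L
      (M.A₂₁ ∘L WithLp.fstL 2 ℂ M.D₁ M.D₂ + M.A₂₂ ∘L WithLp.sndL 2 ℂ M.D₁ M.D₂)

lemma I_apply (M : BlockMatrix H₁ H₂) (y : M.D) :
    M.I y = WithLp.toLp 2 (M.I₁ y.fst, M.I₂ y.snd) := rfl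

lemma A_apply (M : BlockMatrix H₁ H₂) (y z : M.D) :
    M.A y z = (M.A₁₁ y.fst z.fst + M.A₁₂ y.snd z.fst) +
      (M.A₂₁ y.fst z.snd + M.A₂₂ y.snd z.snd) := rfl

/-- The angular extension `T^• = (I*)⁻¹ T I⁻¹` of the operator matrix. -/
def angularExtension (M : BlockMatrix H₁ H₂) : M.Hsum →ₗ.[ℂ] M.Hsum := bullet M.I M.A

lemma graph_angularExtension (M : BlockMatrix H₁ H₂) :
    M.angularExtension.graph = bulletGraph M.I M.A := by
  refine graph_bullet ?_ ?_ _
  · refine (WithLp.prodContinuousLinearEquiv 2 ℂ H₁ H₂).symm.injective.comp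
      ((M.injective_I₁.prodMap M.injective_I₂).comp
        (WithLp.prodContinuousLinearEquiv 2 ℂ M.D₁ M.D₂).injective)
  · refine (WithLp.prodContinuousLinearEquiv 2 ℂ H₁ H₂).symm.surjective.denseRange.comp
      ((M.denseRange_I₁.prodMap M.denseRange_I₂).comp
        (WithLp.prodContinuousLinearEquiv 2 ℂ M.D₁ M.D₂).surjective.denseRange ?_) ?_
    · exact (M.I₁.prodMap M.I₂).continuous
    · exact (WithLp.prodContinuousLinearEquiv 2 ℂ H₁ H₂).symm.continuous

/-- The angular extension extends the original operator matrix. -/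
lemma mem_graph_angularExtension (M : BlockMatrix H₁ H₂) (x : M.T₁₁.domain) (y : M.T₂₂.domain) :
    ((WithLp.toLp 2 ((x : H₁), (y : H₂)), WithLp.toLp 2 (M.T₁₁ x + M.T₁₂ y, M.T₂₁ x + M.T₂₂ y)) :
      M.Hsum × M.Hsum) ∈ M.angularExtension.graph := by
  rw [graph_angularExtension]
  let x' : M.PreD₁ := x
  let y' : M.PreD₂ := y
  refine ⟨WithLp.toLp 2 (M.ι₁ x', M.ι₂ y'), ?_, ?_⟩
  · change WithLp.toLp 2 (M.I₁ (M.ι₁ x'), M.I₂ (M.ι₂ y')) = _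
    rw [I₁_ι₁, I₂_ι₂]
    rfl
  · ext z
    change (M.A₁₁ (M.ι₁ x') z.fst + M.A₁₂ (M.ι₂ y') z.fst) +
      (M.A₂₁ (M.ι₁ x') z.snd + M.A₂₂ (M.ι₂ y') z.snd) = _
    rw [A₁₁_ι₁, A₁₂_ι₂, A₂₁_ι₁, A₂₂_ι₂]
    simp only [rigDual_apply, I_apply, WithLp.prod_inner_apply, inner_add_right]
    rfl

/-- The operator `T₂₂^♮(z) = T₂₂ - z I₂* I₂ : D₂ → D₂*`. -/
def pencil₂₂ (M : BlockMatrix H₁ H₂) (z : ℂ) : M.D₂ →L[ℂ] AntiDual M.D₂ :=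
  M.A₂₂ - z • (rigDual M.I₂ ∘L M.I₂)

/-- The transfer function `S(z) = T₁₁ - z I₁* I₁ - T₁₂ [T₂₂^♮(z)]⁻¹ T₂₁ : D₁ → D₁*`. It is meant
for `z` in the resolvent set of `T₂₂^•`, where `T₂₂^♮(z)` is boundedly invertible. -/
def S (M : BlockMatrix H₁ H₂) (z : ℂ) : M.D₁ →L[ℂ] AntiDual M.D₁ :=
  M.A₁₁ - z • (rigDual M.I₁ ∘L M.I₁) - M.A₁₂ ∘L (M.pencil₂₂ z).inverse ∘L M.A₂₁

end

end BlockMatrix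
end BlockOp
end

/-! ### Compactness, functional calculus and essential positivity in a Hilbert space. -/

section HilbertSpace

/-! On the interval, `S(t)` is a norm-continuous curve of symmetric operators, and the spectral
hypothesis makes each `S(t)` left invertible modulo compact operators. Being positive up to a
compact operator is locally constant along such a curve, and the interval is connected, so the
property passes from one endpoint to the other in either direction. The negative case is the
positive one for `-S`.

Local constancy is `IsEssentiallyPositive.along_curve`, applied after the Riesz isomorphism has
turned `S(t)` into a self-adjoint operator `F` in `D₁`. Openness is immediate. For closedness, left
invertibility gives `F² ≥ η` up to a compact form, while an essentially positive operator within `ρ`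
of `F` gives `F ≥ -ρ` up to a compact form. With `ρ` small against `η`, the two bounds leave no room
for an infinite-dimensional part of `F` below a small positive level: a cutoff `h(F)` to that region
is compact (`isCompactOperator_cfc_of_near`), and adding a multiple of it makes `F` uniformly
positive.

Left invertibility starts from a resolvent `R` of `T^•` at a nearby real point. An isolated
eigenvalue of finite multiplicity of `T^•` becomes one of `R`, and functional calculus inverts off
its eigenspace (`exists_left_parametrix_of_isolated`). This is lifted from `H` to the pencil `T - t
I*I` by comparison with an explicitly invertible operator `T - I*BI`
(`exists_left_parametrix_pencil`), and then compressed to the Schur complement `S(t)`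
(`exists_left_parametrix_S`). For the whole matrix `B = κ ⊕ τ` works, because the norm of `D₁` is
chosen so that the resulting Schur complement is the Riesz map. -/

/-- An operator dominated by a compact operator is compact. -/
theorem IsCompactOperator.of_norm_le {E F G : Type*} [NormedAddCommGroup E] [NormedSpace ℂ E]
    [NormedAddCommGroup F] [NormedSpace ℂ F] [CompleteSpace F]
    [NormedAddCommGroup G] [NormedSpace ℂ G] {a : E →L[ℂ] F} {b : E →L[ℂ] G} {C : ℝ}
    (h : ∀ x, ‖a x‖ ≤ C * ‖b x‖) (hb : IsCompactOperator b) : IsCompactOperator a := by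
  refine (isCompactOperator_iff_isCompact_closure_image_ball (𝕜₁ := ℂ) (a : E →ₗ[ℂ] F)
    one_pos).2 (TotallyBounded.isCompact_of_isClosed ?_ isClosed_closure)
  refine TotallyBounded.closure ?_
  have hB : TotallyBounded (b '' Metric.ball 0 1) :=
    ((hb.isCompact_closure_image_ball (f := (b : E →ₗ[ℂ] G)) (𝕜₁ := ℂ) 1).totallyBounded).subset
      subset_closure
  have hC : 0 < |C| + 1 := by positivity
  rw [Metric.totallyBounded_iff]
  intro ε hε
  -- The net is taken inside the image of the ball, so its points have preimages, whose images under
  -- `a` form the required net. Dividing by `|C| + 1` covers every sign of `C`.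
  obtain ⟨t, hts, htf, hcov⟩ := totallyBounded_iff_subset.1 hB _
    (Metric.dist_mem_uniformity (div_pos hε hC))
  have hts' : ∀ y, ∃ x, y ∈ t → b x = y := fun y => by
    by_cases hy : y ∈ t
    · obtain ⟨x, -, hx⟩ := hts hy
      exact ⟨x, fun _ => hx⟩
    · exact ⟨0, fun h => absurd h hy⟩
  choose g hg using hts'
  refine ⟨(fun y => a (g y)) '' t, htf.image _, ?_⟩
  rintro _ ⟨x, hx, rfl⟩
  obtain ⟨y, hyt, hy⟩ := Set.mem_iUnion₂.1 (hcov ⟨x, hx, rfl⟩)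
  refine Set.mem_iUnion₂.2 ⟨a (g y), ⟨y, hyt, rfl⟩, ?_⟩
  have hy' : ‖b (x - g y)‖ < ε / (|C| + 1) := by
    have : dist (b x) y < ε / (|C| + 1) := hy
    rwa [← hg y hyt, dist_eq_norm, ← map_sub] at this
  change dist (a x) (a (g y)) < ε
  rw [dist_eq_norm, ← map_sub]
  rw [lt_div_iff₀ hC] at hy'
  have h0 := norm_nonneg (b (x - g y))
  have h1 : C * ‖b (x - g y)‖ ≤ |C| * ‖b (x - g y)‖ :=
    mul_le_mul_of_nonneg_right (le_abs_self C) h0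
  linarith [h (x - g y)]

variable {E : Type*} [NormedAddCommGroup E] [InnerProductSpace ℂ E] [CompleteSpace E]

/-- The spectrum lies in `[-M, M]` and the functional calculus preserves positivity. No
self-adjointness or continuity is needed, since `cfc` is `0` when either fails. -/
lemma re_inner_cfc_nonneg {F : E →L[ℂ] E} {f : ℝ → ℝ}
    {M : ℝ} (hM : ‖F‖ ≤ M) (hpos : ∀ x ∈ Set.Icc (-M) M, 0 ≤ f x) (y : E) :
    0 ≤ (⟪y, cfc f F y⟫_ℂ).re := by
  have h : 0 ≤ cfc f F := by
    refine cfc_nonneg fun x hx => hpos x ?_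
    have := (spectrum.norm_le_norm_mul_of_mem hx)
    -- Only an inequality, as `E` may be trivial.
    have h1 : ‖(1 : E →L[ℂ] E)‖ ≤ 1 := ContinuousLinearMap.norm_id_le
    have : |x| ≤ M := by
      rw [Real.norm_eq_abs] at this
      nlinarith [norm_nonneg F]
    exact abs_le.1 this
  exact ((ContinuousLinearMap.nonneg_iff_isPositive _).1 h).re_inner_nonneg_right y

/-- A bounded operator whose quadratic form is uniformly positive up to the form of a compact
operator. -/
def IsEssentiallyPositive (F : E →L[ℂ] E) : Prop :=
  ∃ ε : ℝ, 0 < ε ∧ ∃ K : E →L[ℂ] E, IsCompactOperator K ∧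
    ∀ x, ε * ‖x‖ ^ 2 ≤ (⟪x, F x⟫_ℂ).re + (⟪x, K x⟫_ℂ).re

omit [CompleteSpace E] in
lemma abs_re_inner_apply_le (F : E →L[ℂ] E) (x : E) : |(⟪x, F x⟫_ℂ).re| ≤ ‖F‖ * ‖x‖ ^ 2 := by
  refine (Complex.abs_re_le_norm _).trans ((norm_inner_le_norm _ _).trans ?_)
  have := F.le_opNorm x
  nlinarith [norm_nonneg x]

omit [CompleteSpace E] in
-- A perturbation of norm at most `ε / 2` costs half of the constant `ε`; the compact operator stays
-- the same.
lemma IsEssentiallyPositive.exists_forall_norm_sub_le {F : E →L[ℂ] E}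
    (hF : IsEssentiallyPositive F) :
    ∃ ρ : ℝ, 0 < ρ ∧ ∀ F' : E →L[ℂ] E, ‖F' - F‖ ≤ ρ → IsEssentiallyPositive F' := by
  obtain ⟨ε, hε, K, hK, h⟩ := hF
  refine ⟨ε / 2, by positivity, fun F' hF' => ⟨ε / 2, by positivity, K, hK, fun x => ?_⟩⟩
  have h1 := abs_le.1 (abs_re_inner_apply_le (F' - F) x)
  have h2 := h x
  rw [sub_apply, inner_sub_right, Complex.sub_re] at h1
  nlinarith [sq_nonneg ‖x‖]

/-- The grouping separates `F + ρ` and `F² - η`, the two operators that are nonnegative up to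
compact forms, from the slack `ν`. -/
lemma cfc_quadratic {F : E →L[ℂ] E} (hF : IsSelfAdjoint F) (m ρ η ν : ℝ) :
    cfc (fun x : ℝ => -(m * (x + ρ) + (x * x - η) + ν)) F =
      -(m • (F + ρ • 1) + (F * F - η • 1) + ν • 1) := by
  rw [cfc_neg (fun x : ℝ => m * (x + ρ) + (x * x - η) + ν) F,
    cfc_add F (fun x : ℝ => m * (x + ρ) + (x * x - η)) (fun _ => ν),
    cfc_add F (fun x : ℝ => m * (x + ρ)) (fun x => x * x - η),
    cfc_const_mul m (fun x : ℝ => x + ρ) F, cfc_sub (fun x : ℝ => x * x) (fun _ => η) F,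
    cfc_mul (fun x : ℝ => x) (fun x => x) F, cfc_add F (fun x : ℝ => x) (fun _ => ρ),
    cfc_const _ F, cfc_const _ F, cfc_const _ F, cfc_id' ℝ F]
  simp only [Algebra.algebraMap_eq_smul_one]

/-- An operator whose range carries a compact uniformly positive form is compact. -/
lemma isCompactOperator_of_le_re_inner {a k : E →L[ℂ] E} (hk : IsCompactOperator k) {γ : ℝ}
    (hγ : 0 < γ) (h : ∀ x, γ * ‖a x‖ ^ 2 ≤ (⟪a x, k (a x)⟫_ℂ).re) : IsCompactOperator a := by
  refine IsCompactOperator.of_norm_le (b := k ∘L a) (C := γ⁻¹) (fun x => ?_) (hk.comp_clm a)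
  have hkle : (⟪a x, k (a x)⟫_ℂ).re ≤ ‖a x‖ * ‖k (a x)‖ :=
    (Complex.re_le_norm _).trans (norm_inner_le_norm _ _)
  change ‖a x‖ ≤ γ⁻¹ * ‖k (a x)‖
  rcases (norm_nonneg (a x)).eq_or_lt with h0 | h0
  · rw [← h0]; positivity
  · have : γ * ‖a x‖ ≤ ‖k (a x)‖ := by nlinarith [h x]
    rw [inv_mul_eq_div, le_div_iff₀ hγ]
    linarith

/-- On the support of `h` the polynomial `2M(x + ρ) + (x² - η) + η/4` is nonpositive. For `y` in the
range of `h(F)` this gives `η/4 ‖y‖² ≤ -2M⟨(F + ρ)y, y⟩ - ⟨(F² - η)y, y⟩`, and the right side is at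
most the form of the compact operator `2M K + c`. Hence `h(F)` is compact. -/
lemma isCompactOperator_cfc_of_near {F F' K c : E →L[ℂ] E} (hF : IsSelfAdjoint F)
    {M δ ρ η : ℝ} (hM : ‖F‖ ≤ M) (hM0 : 0 < M) (hη : 0 < η) (hδM : 12 * M * δ = η)
    (hρM : 8 * M * ρ = η) (hc : IsCompactOperator c)
    (hFc : ∀ x, η * ‖x‖ ^ 2 ≤ ‖F x‖ ^ 2 + (⟪x, c x⟫_ℂ).re) (hF' : ‖F' - F‖ ≤ ρ)
    (hK : IsCompactOperator K) (hFK : ∀ x, 0 ≤ (⟪x, F' x⟫_ℂ).re + (⟪x, K x⟫_ℂ).re)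
    {h : ℝ → ℝ} (hcont : Continuous h) (h0 : ∀ x, 0 ≤ h x) (h2 : ∀ x, 2 * δ ≤ x → h x = 0) :
    IsCompactOperator (cfc h F : E →L[ℂ] E) := by
  have hasa : ContinuousLinearMap.adjoint (cfc h F) = cfc h F := cfc_predicate h F
  have hfpos : ∀ x ∈ Set.Icc (-M) M,
      0 ≤ h x * (-(2 * M * (x + ρ) + (x * x - η) + η / 4)) * h x := by
    intro x hx
    rcases le_total (2 * δ) x with hx2 | hx2
    · simp [h2 x hx2]
    -- For `-M ≤ x ≤ 0`, the factor `2M` makes `x² + 2Mx ≤ 0`. For `0 ≤ x ≤ 2δ`, the terms `2Mx`,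
    -- `2Mρ`, `x²` are at most `η/3`, `η/4`, `η/6`, so the sum is at most `0`.
    · have key : 2 * M * (x + ρ) + (x * x - η) + η / 4 ≤ 0 := by
        rcases le_total 0 x with hx0 | hx0
        · nlinarith [hx.1, hx.2, mul_le_mul_of_nonneg_left hx.2 hx0,
            mul_le_mul_of_nonneg_left hx2 hM0.le]
        · nlinarith [hx.1, hx.2]
      exact mul_nonneg (mul_nonneg (h0 x) (neg_nonneg.2 key)) (h0 x)
  have hcfc : cfc (fun x => h x * (-(2 * M * (x + ρ) + (x * x - η) + η / 4)) * h x) F =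
      cfc h F * (-((2 * M : ℝ) • (F + ρ • 1) + (F * F - η • 1) + (η / 4) • 1)) * cfc h F := by
    rw [← cfc_quadratic hF, ← cfc_mul _ _ F hcont.continuousOn (by fun_prop),
      ← cfc_mul _ _ F (Continuous.continuousOn (by fun_prop)) hcont.continuousOn]
  refine isCompactOperator_of_le_re_inner (k := (2 * M) • K + c) ((hK.smul (2 * M)).add hc)
    (γ := η / 4) (by positivity) fun x => ?_
  have hneg := re_inner_cfc_nonneg (F := F) hM hfpos x
  rw [hcfc, mul_apply_eq_comp, mul_apply_eq_comp, ← ContinuousLinearMap.adjoint_inner_left,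
    hasa] at hneg
  generalize cfc h F x = y at hneg ⊢
  have hFF : (⟪y, F (F y)⟫_ℂ).re = ‖F y‖ ^ 2 := by
    rw [← ContinuousLinearMap.adjoint_inner_left, show ContinuousLinearMap.adjoint F = F from hF]
    exact inner_self_eq_norm_sq (𝕜 := ℂ) _
  have hyy : (⟪y, y⟫_ℂ).re = ‖y‖ ^ 2 := inner_self_eq_norm_sq (𝕜 := ℂ) _
  have hc1 := hFc y
  have hk1 := hFK y
  have hdiff := (le_abs_self _).trans (abs_re_inner_apply_le (F' - F) y)
  have hρy := mul_le_mul_of_nonneg_right hF' (sq_nonneg ‖y‖)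
  simp only [neg_apply, add_apply, sub_apply, smul_apply, mul_apply_eq_comp,
    one_apply_eq_self, inner_neg_right, inner_add_right, inner_sub_right,
    inner_smul_right_eq_smul, Complex.neg_re, Complex.add_re, Complex.sub_re, Complex.smul_re,
    smul_eq_mul, hFF, hyy] at hneg hdiff ⊢
  have hlow : 0 ≤ (⟪y, F y⟫_ℂ).re + ρ * ‖y‖ ^ 2 + (⟪y, K y⟫_ℂ).re := by linarith
  have := mul_nonneg hM0.le hlow
  linarith

lemma cfc_id_add_mul_sub {F : E →L[ℂ] E} (hF : IsSelfAdjoint F) {h : ℝ → ℝ} (hcont : Continuous h)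
    (C δ : ℝ) : cfc (fun x => x + C * h x - δ) F = F + C • cfc h F - δ • 1 := by
  have hc := hcont.continuousOn (s := spectrum ℝ F)
  rw [cfc_sub (fun x => x + C * h x) (fun _ => δ) F (by fun_prop) (by fun_prop),
    cfc_add F (fun x => x) (fun x => C * h x) (by fun_prop) (by fun_prop),
    cfc_const_mul _ h F hc, cfc_const _ F, cfc_id' ℝ F, Algebra.algebraMap_eq_smul_one]

/-- If `F` is bounded below up to a compact operator and a nearby operator is essentially
positive, then `F` becomes uniformly positive after adding a self-adjoint compact operator. -/
theorem exists_compact_add_of_near_isEssentiallyPositive {F c : E →L[ℂ] E} (hF : IsSelfAdjoint F)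
    {η : ℝ} (hη : 0 < η) (hc : IsCompactOperator c)
    (hFc : ∀ x, η * ‖x‖ ^ 2 ≤ ‖F x‖ ^ 2 + (⟪x, c x⟫_ℂ).re) :
    ∃ ρ : ℝ, 0 < ρ ∧ ∀ F' : E →L[ℂ] E, ‖F' - F‖ ≤ ρ → IsEssentiallyPositive F' →
      ∃ δ : ℝ, 0 < δ ∧ ∃ K : E →L[ℂ] E, IsCompactOperator K ∧ IsSelfAdjoint K ∧
        ∀ x, δ * ‖x‖ ^ 2 ≤ (⟪x, F x⟫_ℂ).re + (⟪x, K x⟫_ℂ).re := by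
  obtain ⟨M, hM, hM0⟩ : ∃ M : ℝ, ‖F‖ ≤ M ∧ 0 < M := ⟨‖F‖ + 1, by linarith, by positivity⟩
  obtain ⟨δ, hδ, hδM⟩ : ∃ δ : ℝ, 0 < δ ∧ 12 * M * δ = η :=
    ⟨η / (12 * M), by positivity, by field_simp⟩
  obtain ⟨ρ, hρ, hρM⟩ : ∃ ρ : ℝ, 0 < ρ ∧ 8 * M * ρ = η :=
    ⟨η / (8 * M), by positivity, by field_simp⟩
  refine ⟨ρ, hρ, fun F' hF' hpos => ?_⟩
  obtain ⟨ε, hε, K, hK, hFK⟩ := hpos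
  obtain ⟨h, hcont, h0, h1, h2⟩ : ∃ h : ℝ → ℝ, Continuous h ∧ (∀ x, 0 ≤ h x) ∧
      (∀ x, x ≤ δ → h x = 1) ∧ ∀ x, 2 * δ ≤ x → h x = 0 := by
    refine ⟨fun x => max 0 (min 1 (2 - x / δ)), by fun_prop, fun x => le_max_left _ _,
      fun x hx => ?_, fun x hx => ?_⟩
    · have : x / δ ≤ 1 := (div_le_one hδ).2 hx
      simp only
      rw [min_eq_left (by linarith), max_eq_right zero_le_one]
    · have : 2 ≤ x / δ := (le_div_iff₀ hδ).2 hx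
      simp only
      rw [min_eq_right (by linarith), max_eq_left (by linarith)]
  have hcpt : IsCompactOperator (cfc h F : E →L[ℂ] E) :=
    isCompactOperator_cfc_of_near hF hM hM0 hη hδM hρM hc hFc hF' hK
      (fun x => (by positivity : 0 ≤ ε * ‖x‖ ^ 2).trans (hFK x)) hcont h0 h2
  have hasa : IsSelfAdjoint (cfc h F) := cfc_predicate h F
  -- Below `δ`, where `h = 1`, the multiple `M + δ` lifts even `x = -M` up to `δ`; above `δ` nothing
  -- has to be added.
  have hpos : ∀ x ∈ Set.Icc (-M) M, 0 ≤ x + (M + δ) * h x - δ := by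
    intro x hx
    rcases le_total x δ with hxδ | hxδ
    · rw [h1 x hxδ]; linarith [hx.1]
    · have := mul_nonneg (add_pos hM0 hδ).le (h0 x)
      linarith
  have hnn := re_inner_cfc_nonneg (F := F) hM hpos
  rw [cfc_id_add_mul_sub hF hcont] at hnn
  generalize cfc h F = a at hnn hcpt hasa
  have hcpt' : IsCompactOperator ((M + δ) • a : E →L[ℂ] E) := hcpt.smul (M + δ)
  have hasa' : IsSelfAdjoint ((M + δ) • a) := by
    rw [IsSelfAdjoint, star_smul, star_trivial, hasa.star_eq]
  refine ⟨δ, hδ, (M + δ) • a, hcpt', hasa', fun x => ?_⟩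
  have := hnn x
  have hxx : (⟪x, x⟫_ℂ).re = ‖x‖ ^ 2 := inner_self_eq_norm_sq (𝕜 := ℂ) _
  simp only [add_apply, sub_apply, smul_apply, one_apply_eq_self, inner_add_right,
    inner_sub_right, inner_smul_right_eq_smul, Complex.add_re, Complex.sub_re, Complex.smul_re,
    smul_eq_mul, hxx] at this ⊢
  linarith

/-- An operator with a left inverse modulo compact operators is bounded below modulo a compact
operator. -/
lemma exists_lower_bound_of_left_parametrix {F Q k : E →L[ℂ] E} (hk : IsCompactOperator k)
    (hQ : Q ∘L F = ContinuousLinearMap.id ℂ E + k) :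
    ∃ η : ℝ, 0 < η ∧ ∃ c : E →L[ℂ] E, IsCompactOperator c ∧
      ∀ x, η * ‖x‖ ^ 2 ≤ ‖F x‖ ^ 2 + (⟪x, c x⟫_ℂ).re := by
  -- The bound comes from squaring `x = QFx - kx`; the form of `k*k` absorbs `‖kx‖²`. Using `‖Q‖ +
  -- 1` avoids a zero denominator.
  have hN : 0 < 2 * (‖Q‖ + 1) ^ 2 := by positivity
  refine ⟨1 / (2 * (‖Q‖ + 1) ^ 2), by positivity,
    ((‖Q‖ + 1) ^ 2)⁻¹ • (ContinuousLinearMap.adjoint k ∘L k),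
    (hk.clm_comp (ContinuousLinearMap.adjoint k)).smul _, fun x => ?_⟩
  have hx : Q (F x) = x + k x := DFunLike.congr_fun hQ x
  have h1 : ‖x‖ ≤ (‖Q‖ + 1) * ‖F x‖ + ‖k x‖ := by
    have : x = Q (F x) - k x := by rw [hx, add_sub_cancel_right]
    calc ‖x‖ = ‖Q (F x) - k x‖ := by rw [← this]
      _ ≤ ‖Q (F x)‖ + ‖k x‖ := norm_sub_le _ _
      _ ≤ _ := by nlinarith [Q.le_opNorm (F x), norm_nonneg (F x)]
  have hkk : (⟪x, (((‖Q‖ + 1) ^ 2)⁻¹ • (ContinuousLinearMap.adjoint k ∘L k)) x⟫_ℂ).re =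
      ((‖Q‖ + 1) ^ 2)⁻¹ * ‖k x‖ ^ 2 := by
    rw [smul_apply, inner_smul_right_eq_smul, ContinuousLinearMap.comp_apply,
      ContinuousLinearMap.adjoint_inner_right, Complex.smul_re, smul_eq_mul]
    congr 1
    exact inner_self_eq_norm_sq (𝕜 := ℂ) _
  rw [hkk]
  have h2 : ‖x‖ ^ 2 ≤ 2 * ((‖Q‖ + 1) ^ 2 * ‖F x‖ ^ 2 + ‖k x‖ ^ 2) := by
    have := pow_le_pow_left₀ (norm_nonneg x) h1 2
    nlinarith [sq_nonneg ((‖Q‖ + 1) * ‖F x‖ - ‖k x‖)]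
  rw [div_mul_eq_mul_div, one_mul, div_le_iff₀ hN]
  have h3 : (‖F x‖ ^ 2 + ((‖Q‖ + 1) ^ 2)⁻¹ * ‖k x‖ ^ 2) * (2 * (‖Q‖ + 1) ^ 2) =
      2 * ((‖Q‖ + 1) ^ 2 * ‖F x‖ ^ 2 + ‖k x‖ ^ 2) := by
    field_simp
  rw [h3]
  exact h2

/-- Essential positivity is constant along a continuous curve of self-adjoint operators that are
left invertible modulo compact operators. -/
theorem IsEssentiallyPositive.along_curve {F : ℝ → E →L[ℂ] E} {a b : ℝ}
    (hcont : ContinuousOn F (Set.Icc a b)) (hsa : ∀ t ∈ Set.Icc a b, IsSelfAdjoint (F t))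
    (hpar : ∀ t ∈ Set.Icc a b, ∃ Q k : E →L[ℂ] E, IsCompactOperator k ∧
      Q ∘L F t = ContinuousLinearMap.id ℂ E + k)
    {s t : ℝ} (hs : s ∈ Set.Icc a b) (ht : t ∈ Set.Icc a b) (h : IsEssentiallyPositive (F s)) :
    ∃ δ : ℝ, 0 < δ ∧ ∃ K : E →L[ℂ] E, IsCompactOperator K ∧ IsSelfAdjoint K ∧
        ∀ x, δ * ‖x‖ ^ 2 ≤ (⟪x, F t x⟫_ℂ).re + (⟪x, K x⟫_ℂ).re := by
  have key : ∀ t ∈ Set.Icc a b, ∃ ρ : ℝ, 0 < ρ ∧ ∀ F' : E →L[ℂ] E, ‖F' - F t‖ ≤ ρ →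
      IsEssentiallyPositive F' → ∃ δ : ℝ, 0 < δ ∧ ∃ K : E →L[ℂ] E, IsCompactOperator K ∧
      IsSelfAdjoint K ∧ ∀ x, δ * ‖x‖ ^ 2 ≤ (⟪x, F t x⟫_ℂ).re + (⟪x, K x⟫_ℂ).re := by
    intro t ht
    obtain ⟨Q, k, hk, hQ⟩ := hpar t ht
    obtain ⟨η, hη, c, hc, hFc⟩ := exists_lower_bound_of_left_parametrix hk hQ
    exact exists_compact_add_of_near_isEssentiallyPositive (hsa t ht) hη hc hFc
  have hclopen : IsClopen {u : Set.Icc a b | IsEssentiallyPositive (F u)} := by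
    have hG : Continuous fun u : Set.Icc a b => F u := continuousOn_iff_continuous_domRestrict.1 hcont
    constructor
    -- Closedness: the radius `ρ` depends only on the limit operator `F u`, so one essentially
    -- positive operator within that distance suffices, whatever its own constant.
    · rw [← isOpen_compl_iff, isOpen_iff_mem_nhds]
      intro u hu
      obtain ⟨ρ, hρ, hρ'⟩ := key u u.2
      filter_upwards [Metric.continuous_iff'.1 hG u ρ hρ] with v hv hv'
      obtain ⟨δ, hδ, K, hK, -, h⟩ := hρ' (F v) (by rw [← dist_eq_norm]; exact hv.le) hv'
      exact hu ⟨δ, hδ, K, hK, h⟩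
    · rw [isOpen_iff_mem_nhds]
      intro u hu
      obtain ⟨ρ, hρ, hρ'⟩ := IsEssentiallyPositive.exists_forall_norm_sub_le hu
      filter_upwards [Metric.continuous_iff'.1 hG u ρ hρ] with v hv
      exact hρ' (F v) (by rw [← dist_eq_norm]; exact hv.le)
  have : PreconnectedSpace (Set.Icc a b) :=
    isPreconnected_iff_preconnectedSpace.1 isPreconnected_Icc
  have huniv := hclopen.eq_univ ⟨⟨s, hs⟩, h⟩
  have ht' : IsEssentiallyPositive (F t) :=
    (huniv ▸ Set.mem_univ (⟨t, ht⟩ : Set.Icc a b) : (⟨t, ht⟩ : Set.Icc a b) ∈ _)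
  -- Applied with `F' = F t` itself, only to replace the compact operator by a self-adjoint one.
  obtain ⟨ρ, hρ, hρ'⟩ := key t ht
  exact hρ' (F t) (by simpa using hρ.le) ht'

/-- A self-adjoint operator whose spectrum near `a` reduces to an eigenvalue of finite multiplicity
has a left inverse, after subtracting `a`, modulo operators of finite rank. -/
theorem exists_left_parametrix_of_isolated {R : E →L[ℂ] E} (hR : IsSelfAdjoint R) {a r : ℝ}
    (hr : 0 < r) (hiso : ∀ x : ℝ, x ≠ a → |x - a| < r → IsUnit (R - x • (1 : E →L[ℂ] E)))
    (hfin : FiniteDimensional ℂ (LinearMap.ker (R - a • (1 : E →L[ℂ] E)).toLinearMap)) :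
    ∃ Q k : E →L[ℂ] E, IsCompactOperator k ∧
      Q ∘L (R - a • (1 : E →L[ℂ] E)) = ContinuousLinearMap.id ℂ E + k := by
  have hiso' : ∀ x ∈ spectrum ℝ R, |x - a| < r → x = a := by
    intro x hx hxr
    by_contra hne
    refine hx ?_
    rw [spectrum.mem_resolventSet_iff, Algebra.algebraMap_eq_smul_one, ← neg_sub, IsUnit.neg_iff]
    exact hiso x hne hxr
  -- A continuous function equal to `1 / (x - a)` for `|x - a| ≥ r`, hence on the whole spectrum
  -- except possibly at `a`.
  set f : ℝ → ℝ := fun x => (max r |x - a|)⁻¹ * ((max r |x - a|)⁻¹ * (x - a)) with hf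
  have hpos : ∀ x, max r |x - a| ≠ 0 := fun x => (lt_max_of_lt_left hr).ne'
  have hfc : Continuous f := by
    have : Continuous fun x : ℝ => (max r |x - a|)⁻¹ :=
      Continuous.inv₀ (by fun_prop) hpos
    fun_prop
  have hfc' := hfc.continuousOn (s := spectrum ℝ R)
  have hfx : ∀ x ∈ spectrum ℝ R, (f x * (x - a) - 1) * (x - a) = 0 := by
    intro x hx
    by_cases hxa : x = a
    · simp [hxa]
    · have : r ≤ |x - a| := not_lt.1 fun h => hxa (hiso' x hx h)
      have hne : x - a ≠ 0 := sub_ne_zero.2 hxa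
      have : f x * (x - a) = 1 := by
        simp only [hf, max_eq_right this]
        have hring : |x - a|⁻¹ * (|x - a|⁻¹ * (x - a)) * (x - a) =
          (|x - a| ^ 2)⁻¹ * (x - a) ^ 2 := by ring
        rw [hring, sq_abs, inv_mul_cancel₀ (pow_ne_zero 2 hne)]
      rw [this, sub_self, zero_mul]
  have hsub : cfc (fun x => x - a) R = R - a • 1 := by
    rw [cfc_sub (fun x => x) (fun _ => a) R, cfc_const _ R, cfc_id' ℝ R, Algebra.algebraMap_eq_smul_one]
  set k : E →L[ℂ] E := cfc (fun x => f x * (x - a) - 1) R with hk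
  have hk1 : k = cfc f R * (R - a • 1) - 1 := by
    rw [hk, cfc_sub (fun x => f x * (x - a)) (fun _ => 1) R (by fun_prop) (by fun_prop),
      cfc_mul f (fun x => x - a) R (by fun_prop) (by fun_prop), hsub, cfc_const_one ℝ R]
  have hk2 : (R - a • 1) * k = 0 := by
    rw [← hsub, hk, ← cfc_mul (fun x => x - a) (fun x => f x * (x - a) - 1) R (by fun_prop)
      (by fun_prop), ← cfc_const_zero ℝ R]
    refine cfc_congr fun x hx => ?_
    rw [mul_comm]
    exact hfx x hx
  refine ⟨cfc f R, k, ?_, ?_⟩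
  -- Since `(R - a)k = 0`, the operator `k` factors through the finite-dimensional kernel.
  · set N := LinearMap.ker (R - a • (1 : E →L[ℂ] E)).toLinearMap
    have hmem : ∀ x, k x ∈ N := fun x => DFunLike.congr_fun hk2 x
    have : ProperSpace N := FiniteDimensional.proper ℂ N
    have h1 : IsCompactOperator (k.codRestrict N hmem : E →L[ℂ] N) :=
      (isCompactOperator_id (E := N)).comp_clm (k.codRestrict N hmem)
    exact h1.clm_comp N.subtypeL
  · rw [hk1]
    change cfc f R * (R - a • 1) = 1 + (cfc f R * (R - a • 1) - 1)
    rw [add_sub_cancel]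

end HilbertSpace

/-! ### Norm continuity of Schur complements in the parameter. -/

section Continuity

variable {X E F E' F' : Type*} [TopologicalSpace X] [NormedAddCommGroup E] [NormedSpace ℂ E]
  [NormedAddCommGroup F] [NormedSpace ℂ F] [NormedAddCommGroup E'] [NormedSpace ℂ E']
  [NormedAddCommGroup F'] [NormedSpace ℂ F']

lemma ContinuousLinearMap.continuousOn_neg {f : X → E →L[ℂ] F} {s : Set X} (hf : ContinuousOn f s) :
    ContinuousOn (fun x => -f x) s := hf.neg

lemma ContinuousLinearMap.continuous_sub_smul (T Y : E →L[ℂ] F) :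
    Continuous fun t : ℝ => T - (t : ℂ) • Y := by
  fun_prop

/-- Inversion is continuous at an invertible operator. Because `inverse` is total, invertibility is
needed only at the point itself. -/
lemma ContinuousLinearMap.continuousAt_sub_comp_inverse_comp [CompleteSpace E] (T Y : E →L[ℂ] F)
    (T' Y' : E' →L[ℂ] F') (U : E →L[ℂ] F') (V : E' →L[ℂ] F) {t : ℝ} {e : E ≃L[ℂ] F}
    (he : (e : E →L[ℂ] F) = T - (t : ℂ) • Y) :
    ContinuousAt (fun t : ℝ => T' - (t : ℂ) • Y' - U ∘L (T - (t : ℂ) • Y).inverse ∘L V) t := by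
  have h2 : ContinuousAt (ContinuousLinearMap.inverse : (E →L[ℂ] F) → _) (T - (t : ℂ) • Y) := by
    rw [← he]
    exact (contDiffAt_map_inverse (𝕜 := ℂ) (n := 0) e).continuousAt
  have h3 : ContinuousAt (fun t : ℝ => (T - (t : ℂ) • Y).inverse) t :=
    ContinuousAt.comp (f := fun t : ℝ => T - (t : ℂ) • Y) h2
      (continuous_sub_smul T Y).continuousAt
  exact (continuous_sub_smul T' Y').continuousAt.sub
    (continuousAt_const.clm_comp (h3.clm_comp continuousAt_const))

end Continuity

namespace BlockOp

/-! ### Transport to operators `D → D*` through the Riesz isomorphism. -/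

section Antidual

variable {D : Type*} [NormedAddCommGroup D] [InnerProductSpace ℂ D] [CompleteSpace D]

/-- The Riesz isomorphism of a Hilbert space onto its antidual. -/
noncomputable def riesz (D : Type*) [NormedAddCommGroup D] [InnerProductSpace ℂ D]
    [CompleteSpace D] : D ≃L[ℂ] AntiDual D :=
  ContinuousLinearEquiv.ofBijective (innerSLFlip ℂ : D →L[ℂ] AntiDual D)
    (LinearMap.ker_eq_bot'.2 fun x hx => by
      have : ⟪x, x⟫_ℂ = 0 := DFunLike.congr_fun hx x
      exact inner_self_eq_zero.1 this)
    (LinearMap.range_eq_top.2 fun φ => by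
      let ψ : D →L[ℂ] ℂ :=
        { toFun := fun z => conj (φ z)
          map_add' := by simp
          map_smul' := by simp
          cont := Complex.continuous_conj.comp φ.continuous }
      refine ⟨(InnerProductSpace.toDual ℂ D).symm ψ, ?_⟩
      ext z
      have : ⟪(InnerProductSpace.toDual ℂ D).symm ψ, z⟫_ℂ = conj (φ z) :=
        InnerProductSpace.toDual_symm_apply
      change ⟪z, (InnerProductSpace.toDual ℂ D).symm ψ⟫_ℂ = φ z
      rw [← inner_conj_symm, this, Complex.conj_conj])

@[simp] lemma riesz_apply (x z : D) : riesz D x z = ⟪z, x⟫_ℂ := rfl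

@[simp] lemma inner_riesz_symm (φ : AntiDual D) (z : D) : ⟪z, (riesz D).symm φ⟫_ℂ = φ z := by
  rw [← riesz_apply, ContinuousLinearEquiv.apply_symm_apply]

/-- Compact perturbations of uniformly positive operators persist along continuous curves of
symmetric operators that are left invertible modulo compact operators. -/
theorem IsCompactPerturbationOfPositive.along_curve {S : ℝ → D →L[ℂ] AntiDual D} {a b : ℝ}
    (hcont : ContinuousOn S (Set.Icc a b))
    (hsymm : ∀ t ∈ Set.Icc a b, ∀ y z, S t y z = conj (S t z y))
    (hpar : ∀ t ∈ Set.Icc a b, ∃ (Q : AntiDual D →L[ℂ] D) (k : D →L[ℂ] D), IsCompactOperator k ∧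
      Q ∘L S t = ContinuousLinearMap.id ℂ D + k)
    {s t : ℝ} (hs : s ∈ Set.Icc a b) (ht : t ∈ Set.Icc a b)
    (h : IsCompactPerturbationOfPositive (S s)) : IsCompactPerturbationOfPositive (S t) := by
  set J : AntiDual D →L[ℂ] D := ((riesz D).symm : AntiDual D →L[ℂ] D) with hJ
  have hJi : ∀ φ z, ⟪z, J φ⟫_ℂ = φ z := inner_riesz_symm
  have hes : IsEssentiallyPositive (J ∘L S s) := by
    obtain ⟨P, K, ⟨ε, hε, hP⟩, hK, hS⟩ := h
    refine ⟨ε, hε, -(J ∘L K), (hK.clm_comp J).neg, fun x => ?_⟩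
    simp only [hS, ContinuousLinearMap.comp_apply, hJi, neg_apply, inner_neg_right, add_apply,
      Complex.add_re, Complex.neg_re]
    linarith [(hP x).2]
  obtain ⟨δ, hδ, K, hK, hKsa, hle⟩ := hes.along_curve (F := fun t => J ∘L S t)
    (continuousOn_const.clm_comp hcont)
    (fun t ht => by
      rw [ContinuousLinearMap.isSelfAdjoint_iff_isSymmetric]
      intro x y
      change ⟪J (S t x), y⟫_ℂ = ⟪x, J (S t y)⟫_ℂ
      rw [hJi, ← inner_conj_symm, hJi]
      exact (hsymm t ht y x).symm)
    (fun t ht => by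
      obtain ⟨Q, k, hk, hQ⟩ := hpar t ht
      refine ⟨Q ∘L (riesz D : D →L[ℂ] AntiDual D), k, hk, ?_⟩
      rw [← hQ]
      ext x
      simp [hJ]) hs ht
  have hKc : IsCompactOperator ((riesz D : D →L[ℂ] AntiDual D) ∘L K) :=
    hK.clm_comp (riesz D : D →L[ℂ] AntiDual D)
  -- Uniform positivity requires a real form, which is where the self-adjointness of `K` enters.
  refine ⟨S t + (riesz D : D →L[ℂ] AntiDual D) ∘L K, -((riesz D : D →L[ℂ] AntiDual D) ∘L K),
    ⟨δ, hδ, fun y => ⟨?_, ?_⟩⟩, hKc.neg, by abel⟩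
  · have h1 : (S t y y).im = 0 := Complex.conj_eq_iff_im.1 (hsymm t ht y y).symm
    have h2 : (⟪y, K y⟫_ℂ).im = 0 := by
      refine Complex.conj_eq_iff_im.1 ?_
      rw [inner_conj_symm]
      exact (ContinuousLinearMap.isSelfAdjoint_iff_isSymmetric.1 hKsa) y y
    change (S t y y + ⟪y, K y⟫_ℂ).im = 0
    rw [Complex.add_im, h1, h2, add_zero]
  · have := hle y
    rw [ContinuousLinearMap.comp_apply, hJi] at this
    change _ ≤ (S t y y + ⟪y, K y⟫_ℂ).re
    rwa [Complex.add_re]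

omit [CompleteSpace D] in
lemma isCompactPerturbationOfPositive_neg_iff {S : D →L[ℂ] AntiDual D} :
    IsCompactPerturbationOfPositive (-S) ↔ IsCompactPerturbationOfNegative S := by
  constructor
  · rintro ⟨P, K, ⟨ε, hε, hP⟩, hK, hS⟩
    refine ⟨-P, -K, ⟨ε, hε, fun y => ?_⟩, hK.neg, by rw [← neg_neg S, hS]; abel⟩
    simpa using hP y
  · rintro ⟨P, K, ⟨ε, hε, hP⟩, hK, hS⟩
    refine ⟨-P, -K, ⟨ε, hε, fun y => ?_⟩, hK.neg, by rw [hS]; abel⟩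
    have := hP y
    simp only [neg_apply, Complex.neg_im, Complex.neg_re, neg_eq_zero]
    exact ⟨this.1, by linarith⟩

/-- Compact perturbations of uniformly negative operators persist along continuous curves of
symmetric operators that are left invertible modulo compact operators. -/
theorem IsCompactPerturbationOfNegative.along_curve {S : ℝ → D →L[ℂ] AntiDual D} {a b : ℝ}
    (hcont : ContinuousOn S (Set.Icc a b))
    (hsymm : ∀ t ∈ Set.Icc a b, ∀ y z, S t y z = conj (S t z y))
    (hpar : ∀ t ∈ Set.Icc a b, ∃ (Q : AntiDual D →L[ℂ] D) (k : D →L[ℂ] D), IsCompactOperator k ∧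
      Q ∘L S t = ContinuousLinearMap.id ℂ D + k)
    {s t : ℝ} (hs : s ∈ Set.Icc a b) (ht : t ∈ Set.Icc a b)
    (h : IsCompactPerturbationOfNegative (S s)) : IsCompactPerturbationOfNegative (S t) := by
  rw [← isCompactPerturbationOfPositive_neg_iff] at h ⊢
  refine IsCompactPerturbationOfPositive.along_curve (S := fun t => -S t) (ContinuousLinearMap.continuousOn_neg hcont)
    (fun t ht y z => ?_) (fun t ht => ?_) hs ht h
  · simpa using hsymm t ht y z
  · obtain ⟨Q, k, hk, hQ⟩ := hpar t ht
    refine ⟨-Q, k, hk, ?_⟩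
    rw [← hQ]
    ext y
    simp

end Antidual

/-! ### Resolvents of symmetric operators at real points. -/

section Resolvent

variable {H : Type*} [NormedAddCommGroup H] [InnerProductSpace ℂ H]
  {A : H →ₗ.[ℂ] H} {z w : ℂ} {R R' : H →L[ℂ] H}

/-- The resolvent identity. -/
lemma IsResolventAt.resolvent_identity (hR : IsResolventAt A z R) (hR' : IsResolventAt A w R')
    (h : H) : R' (h + (z - w) • R h) = R h := by
  obtain ⟨hx, hx'⟩ := hR.1 h
  have := hR'.2 ⟨R h, hx⟩
  rwa [sub_eq_iff_eq_add.1 hx', add_sub_assoc, ← sub_smul] at this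

/-- From `A - w = (1 - (w - z)R)(A - z)` the inverse must be `(A - z)R' = 1 + (w - z)R'`. -/
lemma IsResolventAt.isUnit_one_sub (hR : IsResolventAt A z R) (hR' : IsResolventAt A w R') :
    IsUnit (1 - (w - z) • R) := by
  refine isUnit_iff_exists.2 ⟨1 + (w - z) • R', ?_, ?_⟩
  · ext h
    have := hR'.resolvent_identity hR h
    change h + (w - z) • R' h - (w - z) • R (h + (w - z) • R' h) = h
    rw [this, add_sub_cancel_right]
  · ext h
    have := hR.resolvent_identity hR' h
    change h - (w - z) • R h + (w - z) • R' (h - (w - z) • R h) = h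
    rw [sub_eq_add_neg, ← neg_smul, neg_sub, this, add_assoc, ← add_smul]
    simp

lemma IsResolventAt.isSelfAdjoint [CompleteSpace H] {μ : ℝ} (hR : IsResolventAt A μ R)
    (hA : ∀ x y : A.domain, ⟪A x, (y : H)⟫_ℂ = ⟪(x : H), A y⟫_ℂ) : IsSelfAdjoint R := by
  rw [ContinuousLinearMap.isSelfAdjoint_iff_isSymmetric]
  intro h k
  change ⟪R h, k⟫_ℂ = ⟪h, R k⟫_ℂ
  obtain ⟨hx, hx'⟩ := hR.1 h
  obtain ⟨hy, hy'⟩ := hR.1 k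
  conv_lhs => rw [← hy']
  conv_rhs => rw [← hx']
  rw [inner_sub_left, inner_sub_right, inner_smul_left, inner_smul_right, Complex.conj_ofReal]
  congr 1
  exact (hA ⟨R h, hx⟩ ⟨R k, hy⟩).symm

lemma IsResolventAt.mem_eigenspace (hR : IsResolventAt A z R) {a : ℂ} (ha : a ≠ 0) {x : H}
    (hx : R x = a • x) : x ∈ eigenspace A (z + a⁻¹) := by
  obtain ⟨hd, hd'⟩ := hR.1 x
  change (x, (z + a⁻¹) • x) ∈ A.graph
  have h1 : (R x, x + z • R x) ∈ A.graph := by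
    rw [LinearPMap.mem_graph_iff]
    exact ⟨⟨R x, hd⟩, rfl, (sub_eq_iff_eq_add.1 hd')⟩
  have h2 := A.graph.smul_mem a⁻¹ h1
  have h3 : a⁻¹ • (R x, x + z • R x) = (x, (z + a⁻¹) • x) := by
    ext
    · simp [hx, smul_smul, inv_mul_cancel₀ ha]
    · simp only [Prod.smul_snd, hx, smul_add, add_smul, smul_smul]
      rw [add_comm, mul_comm z a, inv_mul_cancel_left₀ ha]
  rwa [h3] at h2

/-- At a real regular point, or an isolated eigenvalue of finite multiplicity, of a symmetric
operator `A`, the operator `A - t` composed with a suitable resolvent is left invertible modulo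
compact operators. -/
theorem exists_resolvent_left_parametrix [CompleteSpace H]
    (hA : ∀ x y : A.domain, ⟪A x, (y : H)⟫_ℂ = ⟪(x : H), A y⟫_ℂ) {t : ℝ}
    (ht : (t : ℂ) ∈ spectrum A → IsIsolatedFiniteEigenvalue A t) :
    ∃ (μ : ℝ) (R : H →L[ℂ] H), IsResolventAt A μ R ∧ ∃ Q k : H →L[ℂ] H, IsCompactOperator k ∧
      Q ∘L (ContinuousLinearMap.id ℂ H + ((μ : ℂ) - t) • R) = ContinuousLinearMap.id ℂ H + k := by
  by_cases htr : (t : ℂ) ∈ resolventSet A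
  · obtain ⟨R, hR⟩ := htr
    -- At a regular point take `μ = t`: the operator to be inverted is then the identity.
    exact ⟨t, R, hR, ContinuousLinearMap.id ℂ H, 0, isCompactOperator_zero, by simp⟩
  obtain ⟨-, ⟨r, hr, hiso⟩, -, hfin⟩ := ht htr
  have hres : ∀ w : ℝ, w ≠ t → |w - t| < r → (w : ℂ) ∈ resolventSet A := by
    intro w hwt hw
    by_contra hn
    refine hwt (Complex.ofReal_injective (hiso w hn ?_))
    rwa [Complex.dist_of_im_eq (by simp), Complex.ofReal_re, Complex.ofReal_re, Real.dist_eq]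
  -- With the resolvent taken at `μ = t + s`, the point `t` corresponds to the point `1 / (t - μ) =
  -- -1/s` of `R`.
  obtain ⟨s, hs, hsr⟩ : ∃ s : ℝ, 0 < s ∧ s < r := ⟨r / 2, by positivity, by linarith⟩
  obtain ⟨R, hR⟩ := hres (t + s) (by linarith) (by rwa [add_sub_cancel_left, abs_of_pos hs])
  have hRsa := hR.isSelfAdjoint hA
  -- A point `x` for `R` corresponds to `t + s + 1/x` for `A`. Within `1/(2s)` of `-1/s` one has `0
  -- < -1/x < 2s`, so this point lies within `s < r` of `t` and is regular.
  have hisoR : ∀ x : ℝ, x ≠ -s⁻¹ → |x - -s⁻¹| < (2 * s)⁻¹ →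
      IsUnit (R - x • (1 : H →L[ℂ] H)) := by
    intro x hxa hx
    have hx2 : (2 * s)⁻¹ < -x := by
      have h1 := (abs_lt.1 hx).2
      have h2 : s⁻¹ = (2 * s)⁻¹ + (2 * s)⁻¹ := by field_simp; norm_num
      linarith
    have hx0 : x < 0 := by
      have : 0 < (2 * s)⁻¹ := by positivity
      linarith
    have hxs : s + x⁻¹ = s * x⁻¹ * (x - -s⁻¹) := by
      field_simp [hx0.ne]
      ring
    have hne : s + x⁻¹ ≠ 0 := by
      rw [hxs]
      exact mul_ne_zero (mul_ne_zero hs.ne' (inv_ne_zero hx0.ne)) (sub_ne_zero.2 hxa)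
    have hlt : |s + x⁻¹| < r := by
      have h1 : 1 < 2 * s * -x := by
        rwa [inv_lt_iff_one_lt_mul₀ (by positivity), mul_comm] at hx2
      have h2 : -x⁻¹ < 2 * s := by
        rw [← inv_neg, inv_lt_iff_one_lt_mul₀ (by linarith)]
        linarith
      have h3 : x⁻¹ < 0 := inv_lt_zero.2 hx0
      exact (abs_lt.2 ⟨by linarith, by linarith⟩).trans hsr
    obtain ⟨R', hR'⟩ := hres (t + s + x⁻¹) (fun h => hne (by linarith))
      (by rwa [add_assoc, add_sub_cancel_left])
    have hu := hR.isUnit_one_sub hR'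
    have heq : R - x • (1 : H →L[ℂ] H) = (-(x : ℂ)) • (1 -
        (((t + s + x⁻¹ : ℝ) : ℂ) - ((t + s : ℝ) : ℂ)) • R) := by
      have hxc : (x : ℂ) ≠ 0 := Complex.ofReal_ne_zero.2 hx0.ne
      have h1 : (((t + s + x⁻¹ : ℝ) : ℂ) - ((t + s : ℝ) : ℂ)) = (x : ℂ)⁻¹ := by
        push_cast
        ring
      rw [h1, smul_sub, smul_smul, neg_mul, mul_inv_cancel₀ hxc, neg_smul, neg_smul, one_smul,
        sub_neg_eq_add, neg_add_eq_sub]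
      rfl
    rw [heq]
    have hxc : -(x : ℂ) ≠ 0 := neg_ne_zero.2 (Complex.ofReal_ne_zero.2 hx0.ne)
    exact hu.smul (Units.mk0 _ hxc)
  have hfinR : FiniteDimensional ℂ
      (LinearMap.ker (R - (-s⁻¹) • (1 : H →L[ℂ] H)).toLinearMap) := by
    have hsc : ((-s⁻¹ : ℝ) : ℂ) ≠ 0 :=
      Complex.ofReal_ne_zero.2 (neg_ne_zero.2 (inv_ne_zero hs.ne'))
    have hz : ((t + s : ℝ) : ℂ) + ((-s⁻¹ : ℝ) : ℂ)⁻¹ = t := by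
      push_cast
      rw [inv_neg, inv_inv, add_neg_cancel_right]
    refine Submodule.finiteDimensional_of_le (S₂ := eigenspace A t) fun x hx => ?_
    rw [← hz]
    refine hR.mem_eigenspace hsc ?_
    have : R x - (-s⁻¹ : ℝ) • x = 0 := hx
    rw [Complex.coe_smul]
    exact sub_eq_zero.1 this
  obtain ⟨Q, k, hk, hQ⟩ :=
    exists_left_parametrix_of_isolated hRsa (by positivity) hisoR hfinR
  refine ⟨t + s, R, hR, s⁻¹ • Q, k, hk, ?_⟩
  rw [← hQ]
  ext h
  have : h + s • R h = s • (R h - (-s⁻¹) • h) := by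
    rw [smul_sub, smul_smul, mul_neg, mul_inv_cancel₀ hs.ne', neg_one_smul, sub_neg_eq_add,
      add_comm]
  have h2 : ((((t + s : ℝ) : ℂ) - t) • R h) = s • R h := by
    push_cast
    rw [add_sub_cancel_left]
    exact Complex.coe_smul s (R h)
  change s⁻¹ • Q (h + (((t + s : ℝ) : ℂ) - t) • R h) = Q (R h - (-s⁻¹) • h)
  rw [h2, this, Q.map_smul_of_tower, smul_smul, inv_mul_cancel₀ hs.ne', one_smul]

end Resolvent

/-! ### From resolvents of `T^•` in `H` to the pencil `T - z I*I : D → D*`. -/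

section Pencil

variable {H D : Type*} [NormedAddCommGroup H] [InnerProductSpace ℂ H]
  [NormedAddCommGroup D] [InnerProductSpace ℂ D] {I : D →L[ℂ] H} {T : D →L[ℂ] AntiDual D}

/-- The pencil `T - z I* I`. -/
noncomputable def pencil (I : D →L[ℂ] H) (T : D →L[ℂ] AntiDual D) (z : ℂ) : D →L[ℂ] AntiDual D :=
  T - z • (rigDual I ∘L I)

lemma exists_of_isResolventAt (hg : (bullet I T).graph = bulletGraph I T) {z : ℂ} {R : H →L[ℂ] H}
    (hR : IsResolventAt (bullet I T) z R) (h : H) :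
    ∃ y, I y = R h ∧ T y = rigDual I (h + z • R h) := by
  obtain ⟨hx, hx'⟩ := hR.1 h
  have := (bullet I T).mem_graph ⟨R h, hx⟩
  rw [hg, sub_eq_iff_eq_add.1 hx'] at this
  exact this

lemma resolvent_apply_of_eq (hg : (bullet I T).graph = bulletGraph I T) {z : ℂ} {R : H →L[ℂ] H}
    (hR : IsResolventAt (bullet I T) z R) {y : D} {h : H} (hy : T y = rigDual I h) :
    R (h - z • I y) = I y := by
  have : (I y, h) ∈ (bullet I T).graph := by
    rw [hg]
    exact ⟨y, rfl, hy⟩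
  obtain ⟨x, hx, hx'⟩ := (LinearPMap.mem_graph_iff _).1 this
  simp only at hx hx'
  rw [← hx, ← hx']
  exact hR.2 x

lemma bullet_symmetric (hg : (bullet I T).graph = bulletGraph I T)
    (hT : ∀ y z, T y z = conj (T z y)) (x y : (bullet I T).domain) :
    ⟪bullet I T x, (y : H)⟫_ℂ = ⟪(x : H), bullet I T y⟫_ℂ := by
  have hx := (bullet I T).mem_graph x
  have hy := (bullet I T).mem_graph y
  rw [hg] at hx hy
  obtain ⟨u, hu, hu'⟩ := hx
  obtain ⟨v, hv, hv'⟩ := hy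
  simp only at hu hu' hv hv'
  rw [← hu, ← hv, ← rigDual_apply, ← hv', hT, hu', rigDual_apply, inner_conj_symm]

variable {B : H →L[ℂ] H} {W : AntiDual D →L[ℂ] D}

/-- The relation between a resolvent of `T^•` and the inverse of the shifted operator
`T - I* B I`. -/
lemma resolvent_apply_eq (hg : (bullet I T).graph = bulletGraph I T)
    (hW : ∀ y, W (T y - rigDual I (B (I y))) = y) {z : ℂ} {R : H →L[ℂ] H}
    (hR : IsResolventAt (bullet I T) z R) (h : H) :
    R h = I (W (rigDual I h)) - I (W (rigDual I (B (R h) - z • R h))) := by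
  obtain ⟨y, hy, hy'⟩ := exists_of_isResolventAt hg hR h
  have := hW y
  rw [hy', hy, ← map_sub] at this
  rw [← map_sub, ← map_sub, ← map_sub, ← hy, ← this, this, hy]
  conv_lhs => rw [← hy, ← this]
  congr 3
  abel

/-- The vector `y = W I*h` solves `Ty = I*(h + BIy)`, so `Iy` lies in the domain of `T^•`. Together
with `resolvent_apply_eq` this gives both second resolvent identities for `R` and `I W I*`. -/
lemma resolvent_apply_eq' (hg : (bullet I T).graph = bulletGraph I T)
    (hW : ∀ φ, T (W φ) - rigDual I (B (I (W φ))) = φ) {z : ℂ} {R : H →L[ℂ] H}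
    (hR : IsResolventAt (bullet I T) z R) (h : H) :
    R (h + (B (I (W (rigDual I h))) - z • I (W (rigDual I h)))) = I (W (rigDual I h)) := by
  have h1 : T (W (rigDual I h)) = rigDual I (h + B (I (W (rigDual I h)))) := by
    rw [map_add]
    exact sub_eq_iff_eq_add.1 (hW (rigDual I h))
  have := resolvent_apply_of_eq hg hR h1
  rwa [add_sub_assoc] at this

/-- At a regular point of `T^•` the pencil is invertible. -/
theorem exists_equiv_pencil (hg : (bullet I T).graph = bulletGraph I T)
    (hW : ∀ y, W (T y - rigDual I (B (I y))) = y)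
    (hW' : ∀ φ, T (W φ) - rigDual I (B (I (W φ))) = φ)
    {z : ℂ} (hz : z ∈ resolventSet (bullet I T)) :
    ∃ e : D ≃L[ℂ] AntiDual D, (e : D →L[ℂ] AntiDual D) = pencil I T z := by
  obtain ⟨R, hR⟩ := hz
  -- The pencil is `(T - I*BI) + I*CI`, so `W` turns it into `1 + YI` with `Y = W I*C`. The
  -- identities `h1`, `h2` say that `1 - RC` inverts `1 + IY` in `H`; hence `N = 1 - Y(1 - RC)I`
  -- inverts `1 + YI` in `D`.
  set C : H →L[ℂ] H := B - z • ContinuousLinearMap.id ℂ H with hC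
  have hCv : ∀ v, C v = B v - z • v := fun v => rfl
  set Y : H →L[ℂ] D := W ∘L rigDual I ∘L C with hY
  have hYv : ∀ v, Y v = W (rigDual I (C v)) := fun v => rfl
  have hp : ∀ y, pencil I T z y = (T y - rigDual I (B (I y))) + rigDual I (C (I y)) := fun y => by
    change T y - z • rigDual I (I y) = _
    rw [hCv, map_sub, map_smul]
    abel
  have h1 : ∀ v, R (C v) = I (Y v) - I (Y (R (C v))) := fun v =>
    resolvent_apply_eq hg hW hR (C v)
  have h2 : ∀ v, R (C v + C (I (Y v))) = I (Y v) := fun v => resolvent_apply_eq' hg hW' hR (C v)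
  let N : D →L[ℂ] D := ContinuousLinearMap.id ℂ D - Y ∘L I + Y ∘L R ∘L C ∘L I
  have hN : ∀ y, N y = y - Y (I y) + Y (R (C (I y))) := fun y => rfl
  have hN1 : ∀ y, N (y + Y (I y)) = y := fun y => by
    have := h2 (I y)
    rw [hN]
    simp only [map_add] at this ⊢
    rw [← map_add Y (R _), this]
    abel
  have hN2 : ∀ y, N y + Y (I (N y)) = y := fun y => by
    have := congrArg Y (h1 (I y))
    rw [hN]
    simp only [map_add, map_sub] at this ⊢
    rw [eq_sub_iff_add_eq] at this
    rw [← this]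
    abel
  refine ⟨ContinuousLinearEquiv.equivOfInverse (pencil I T z) (N ∘L W) (fun y => ?_) (fun φ => ?_),
    rfl⟩
  · change N (W (pencil I T z y)) = y
    rw [hp, map_add, hW, ← hYv, hN1]
  · change pencil I T z (N (W φ)) = φ
    have h4 : ∀ v, T (Y v) - rigDual I (B (I (Y v))) = rigDual I (C v) := fun v => hW' _
    have h5 := hW' φ
    rw [hp, ← h4]
    conv_rhs => rw [← h5, ← hN2 (W φ)]
    simp only [map_add]
    abel

/-- At a regular point or an isolated eigenvalue of finite multiplicity of the symmetric operator
`T^•`, the pencil is left invertible modulo compact operators. -/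
theorem exists_left_parametrix_pencil [CompleteSpace H]
    (hg : (bullet I T).graph = bulletGraph I T) (hT : ∀ y z, T y z = conj (T z y))
    (hW : ∀ y, W (T y - rigDual I (B (I y))) = y)
    (hW' : ∀ φ, T (W φ) - rigDual I (B (I (W φ))) = φ)
    {t : ℝ} (ht : (t : ℂ) ∈ spectrum (bullet I T) → IsIsolatedFiniteEigenvalue (bullet I T) t) :
    ∃ (Q : AntiDual D →L[ℂ] D) (k : D →L[ℂ] D), IsCompactOperator k ∧
      Q ∘L pencil I T t = ContinuousLinearMap.id ℂ D + k := by
  obtain ⟨μ, R, hR, Q, k, hk, hQ⟩ := exists_resolvent_left_parametrix (bullet_symmetric hg hT) ht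
  set C : H →L[ℂ] H := B - (t : ℂ) • ContinuousLinearMap.id ℂ H with hC
  set C' : H →L[ℂ] H := B - (μ : ℂ) • ContinuousLinearMap.id ℂ H with hC'
  have hCv : ∀ v, C v = B v - (t : ℂ) • v := fun v => rfl
  have hCv' : ∀ v, C' v = B v - (μ : ℂ) • v := fun v => rfl
  set Y : H →L[ℂ] D := W ∘L rigDual I ∘L C with hY
  have hYv : ∀ v, Y v = W (rigDual I (C v)) := fun v => rfl
  have hp : ∀ y, pencil I T t y = (T y - rigDual I (B (I y))) + rigDual I (C (I y)) := fun y => by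
    change T y - (t : ℂ) • rigDual I (I y) = _
    rw [hCv, map_sub, map_smul]
    abel
  have h2 : ∀ v, R (C v + C' (I (Y v))) = I (Y v) := fun v => resolvent_apply_eq' hg hW' hR (C v)
  have hQv : ∀ v, Q (v + ((μ : ℂ) - t) • R v) = v + k v := fun v => DFunLike.congr_fun hQ v
  -- Since `C = C' + (μ - t)`, the identity `h2` becomes `(1 - RC')(1 + IY) = 1 + (μ - t)R`, to
  -- which `Q` is a left parametrix. So `Q(1 - RC')` is one for `1 + IY`, and `N = 1 - YQ(1 - RC')I`
  -- satisfies `N(1 + YI) = 1 - YkI`.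
  have h3 : ∀ v, Q ((v + I (Y v)) - R (C' (v + I (Y v)))) = v + k v := fun v => by
    rw [← hQv]
    congr 1
    have := h2 v
    rw [map_add, hCv, map_sub, map_smul] at this
    rw [map_add C', map_add R, hCv', map_sub, map_smul, sub_smul, ← sub_eq_zero]
    rw [← sub_eq_zero] at this
    rw [← neg_eq_zero, ← this]
    abel
  let Q' : H →L[ℂ] H := Q ∘L (ContinuousLinearMap.id ℂ H - R ∘L C')
  let N : D →L[ℂ] D := ContinuousLinearMap.id ℂ D - Y ∘L Q' ∘L I
  have hN : ∀ y, N y = y - Y (Q (I y - R (C' (I y)))) := fun y => rfl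
  refine ⟨N ∘L W, -(Y ∘L k ∘L I), ((hk.comp_clm I).clm_comp Y).neg, ?_⟩
  ext y
  change N (W (pencil I T t y)) = y + -(Y (k (I y)))
  rw [hp, map_add, hW, ← hYv, hN, map_add I, h3, map_add Y]
  abel

end Pencil

end BlockOp

/-! ### The operator matrix: explicit forms, Schur complements and the transfer function. -/

noncomputable section

namespace BlockOp
namespace BlockMatrix

variable {H₁ H₂ : Type*} [NormedAddCommGroup H₁] [InnerProductSpace ℂ H₁] [CompleteSpace H₁]
  [NormedAddCommGroup H₂] [InnerProductSpace ℂ H₂] [CompleteSpace H₂]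

omit [CompleteSpace H₁] in
lemma A₂₂_apply (M : BlockMatrix H₁ H₂) (y z : M.D₂) :
    M.A₂₂ y z = (M.τ : ℂ) * ⟪M.I₂ z, M.I₂ y⟫_ℂ - ⟪z, y⟫_ℂ := by
  rw [A₂₂_eq]
  rfl

omit [CompleteSpace H₁] in
lemma A₂₂_symm (M : BlockMatrix H₁ H₂) (y z : M.D₂) : M.A₂₂ y z = conj (M.A₂₂ z y) := by
  simp only [A₂₂_apply, map_sub, map_mul, inner_conj_symm, Complex.conj_ofReal]

lemma A₂₁_apply_eq_conj (M : BlockMatrix H₁ H₂) (y : M.D₁) (z : M.D₂) :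
    M.A₂₁ y z = conj (M.A₁₂ z y) := by
  refine M.denseRange_ι₁.induction_on y (isClosed_eq (by fun_prop) ?_) fun x => ?_
  · exact Complex.continuous_conj.comp (by fun_prop)
  refine M.denseRange_ι₂.induction_on z (isClosed_eq (by fun_prop) ?_) fun w => ?_
  · exact Complex.continuous_conj.comp (by fun_prop)
  rw [A₂₁_ι₁, A₁₂_ι₂, rigDual_apply, rigDual_apply, I₁_ι₁, I₂_ι₂, ← op₂₁_op₁₂, inner_conj_symm]

/-- The bounded operator `G : D₁ → D₂` representing `T₂₁`: `⟪z, G y⟫ = ⟨T₂₁ y, z⟩`. -/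
def repr₂₁ (M : BlockMatrix H₁ H₂) : M.D₁ →L[ℂ] M.D₂ :=
  ((riesz M.D₂).symm : AntiDual M.D₂ →L[ℂ] M.D₂) ∘L M.A₂₁

lemma inner_repr₂₁ (M : BlockMatrix H₁ H₂) (y : M.D₁) (z : M.D₂) :
    ⟪z, M.repr₂₁ y⟫_ℂ = M.A₂₁ y z := inner_riesz_symm _ _

lemma repr₂₁_ι₁ (M : BlockMatrix H₁ H₂) (x : M.PreD₁) :
    M.repr₂₁ (M.ι₁ x) = ContinuousLinearMap.adjoint M.I₂ (M.op₂₁ x) := by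
  refine ext_inner_left ℂ fun z => ?_
  rw [inner_repr₂₁, A₂₁_ι₁, rigDual_apply, ContinuousLinearMap.adjoint_inner_right]

lemma A₁₂_apply (M : BlockMatrix H₁ H₂) (z : M.D₂) (y : M.D₁) :
    M.A₁₂ z y = ⟪M.repr₂₁ y, z⟫_ℂ := by
  rw [← inner_conj_symm, inner_repr₂₁, A₂₁_apply_eq_conj, Complex.conj_conj]

/-- On `dom T₁₁` the term `⟨(τ - T₂₂^•)⁻¹ T₂₁ y, T₂₁ z⟩` of the inner product is the form of `G*G`,
with `G = repr₂₁`; density does the rest. -/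
lemma A₁₁_apply (M : BlockMatrix H₁ H₂) (y z : M.D₁) :
    M.A₁₁ y z = ⟪z, y⟫_ℂ - ⟪M.repr₂₁ z, M.repr₂₁ y⟫_ℂ + (M.κ : ℂ) * ⟪M.I₁ z, M.I₁ y⟫_ℂ := by
  refine M.denseRange_ι₁.induction_on y (isClosed_eq (by fun_prop) (by fun_prop)) fun x => ?_
  refine M.denseRange_ι₁.induction_on z (isClosed_eq (by fun_prop) (by fun_prop)) fun w => ?_
  rw [A₁₁_ι₁, rigDual_apply, I₁_ι₁, I₁_ι₁, inner_ι₁, inner_preD₁, inner_resolvent₂, repr₂₁_ι₁,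
    repr₂₁_ι₁, inner_sub_right, inner_smul_right]
  ring

lemma A₁₁_symm (M : BlockMatrix H₁ H₂) (y z : M.D₁) : M.A₁₁ y z = conj (M.A₁₁ z y) := by
  simp only [A₁₁_apply, map_add, map_sub, map_mul, inner_conj_symm, Complex.conj_ofReal]

lemma A_symm (M : BlockMatrix H₁ H₂) (y z : M.D) : M.A y z = conj (M.A z y) := by
  rw [A_apply, A_apply]
  simp only [map_add]
  rw [← A₁₁_symm, ← A₂₂_symm, ← A₂₁_apply_eq_conj, A₂₁_apply_eq_conj M z.fst, Complex.conj_conj]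
  ring

omit [CompleteSpace H₁] in
lemma pencil₂₂_symm (M : BlockMatrix H₁ H₂) (t : ℝ) (y z : M.D₂) :
    M.pencil₂₂ t y z = conj (M.pencil₂₂ t z y) := by
  change M.A₂₂ y z - (t : ℂ) * ⟪M.I₂ z, M.I₂ y⟫_ℂ =
    conj (M.A₂₂ z y - (t : ℂ) * ⟪M.I₂ y, M.I₂ z⟫_ℂ)
  simp only [map_sub, map_mul, inner_conj_symm, Complex.conj_ofReal, ← A₂₂_symm]

omit [CompleteSpace H₁] in
-- The comparison operator is `B = τ`, since `T₂₂ - τ I₂*I₂` is minus the Riesz map.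
lemma exists_equiv_pencil₂₂ (M : BlockMatrix H₁ H₂) {z : ℂ} (hz : z ∈ resolventSet M.friedrichs) :
    ∃ e : M.D₂ ≃L[ℂ] AntiDual M.D₂, (e : M.D₂ →L[ℂ] AntiDual M.D₂) = M.pencil₂₂ z := by
  have key : ∀ y, M.A₂₂ y - rigDual M.I₂ (((M.τ : ℂ) • ContinuousLinearMap.id ℂ H₂) (M.I₂ y)) =
      -riesz M.D₂ y := fun y => by
    ext z
    simp only [sub_apply, neg_apply, smul_apply, A₂₂_apply, rigDual_apply, riesz_apply,
      ContinuousLinearMap.id_apply, inner_smul_right]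
    ring
  refine exists_equiv_pencil (B := (M.τ : ℂ) • ContinuousLinearMap.id ℂ H₂)
    (W := -((riesz M.D₂).symm : AntiDual M.D₂ →L[ℂ] M.D₂)) M.graph_friedrichs
    (fun y => ?_) (fun φ => ?_) hz
  · rw [key]
    simp
  · rw [key]
    simp

/-- The embedding of `D₁` into `D₁ ⊕ D₂`. -/
def inl (M : BlockMatrix H₁ H₂) : M.D₁ →L[ℂ] M.D :=
  (WithLp.prodContinuousLinearEquiv 2 ℂ M.D₁ M.D₂).symm.toContinuousLinearMap ∘L
    ContinuousLinearMap.inl ℂ M.D₁ M.D₂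

/-- The embedding of `D₂` into `D₁ ⊕ D₂`. -/
def inr (M : BlockMatrix H₁ H₂) : M.D₂ →L[ℂ] M.D :=
  (WithLp.prodContinuousLinearEquiv 2 ℂ M.D₁ M.D₂).symm.toContinuousLinearMap ∘L
    ContinuousLinearMap.inr ℂ M.D₁ M.D₂

@[simp] lemma fst_inl (M : BlockMatrix H₁ H₂) (y : M.D₁) : (M.inl y).fst = y := rfl
@[simp] lemma snd_inl (M : BlockMatrix H₁ H₂) (y : M.D₁) : (M.inl y).snd = 0 := rfl
@[simp] lemma fst_inr (M : BlockMatrix H₁ H₂) (y : M.D₂) : (M.inr y).fst = 0 := rfl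
@[simp] lemma snd_inr (M : BlockMatrix H₁ H₂) (y : M.D₂) : (M.inr y).snd = y := rfl

lemma inl_add_inr (M : BlockMatrix H₁ H₂) (y : M.D) : M.inl y.fst + M.inr y.snd = y := by
  apply (WithLp.equiv 2 _).injective
  ext <;> simp [inl, inr]

/-- The diagonal operator `κ ⊕ τ` in `H₁ ⊕ H₂`. -/
def shift (M : BlockMatrix H₁ H₂) : M.Hsum →L[ℂ] M.Hsum :=
  (WithLp.prodContinuousLinearEquiv 2 ℂ H₁ H₂).symm.toContinuousLinearMap ∘L
    (((M.κ : ℂ) • ContinuousLinearMap.id ℂ H₁).prodMap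
      ((M.τ : ℂ) • ContinuousLinearMap.id ℂ H₂)) ∘L
      (WithLp.prodContinuousLinearEquiv 2 ℂ H₁ H₂).toContinuousLinearMap

/-- Up to Riesz maps, the shifted operator is the matrix with rows `(1 - G*G, G*)` and `(G, -1)`.
The Schur complement of the block `-1` is `1 - G*G + G*G = 1`, whence the explicit inverse. -/
lemma shifted_apply (M : BlockMatrix H₁ H₂) (y z : M.D) :
    (M.A y - rigDual M.I (M.shift (M.I y))) z =
      (⟪z.fst, y.fst⟫_ℂ - ⟪M.repr₂₁ z.fst, M.repr₂₁ y.fst - y.snd⟫_ℂ) +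
        ⟪z.snd, M.repr₂₁ y.fst - y.snd⟫_ℂ := by
  have h1 : rigDual M.I (M.shift (M.I y)) z =
      ⟪M.I₁ z.fst, (M.κ : ℂ) • M.I₁ y.fst⟫_ℂ + ⟪M.I₂ z.snd, (M.τ : ℂ) • M.I₂ y.snd⟫_ℂ := rfl
  rw [sub_apply, h1, A_apply, A₁₁_apply, A₁₂_apply, A₂₂_apply, ← inner_repr₂₁]
  simp only [inner_sub_right, inner_smul_right]
  ring

/-- The inverse of `T - I* (κ ⊕ τ) I : D → D*`, obtained from the Schur complement. -/
def shiftedInverse (M : BlockMatrix H₁ H₂) : AntiDual M.D →L[ℂ] M.D :=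
  let Y : AntiDual M.D →L[ℂ] M.D₂ :=
    ((riesz M.D₂).symm : AntiDual M.D₂ →L[ℂ] M.D₂) ∘L antidualMap M.inr
  let X : AntiDual M.D →L[ℂ] M.D₁ :=
    ((riesz M.D₁).symm : AntiDual M.D₁ →L[ℂ] M.D₁) ∘L (antidualMap M.inl + M.A₁₂ ∘L Y)
  M.inl ∘L X + M.inr ∘L (M.repr₂₁ ∘L X - Y)

lemma inner_shiftedInverse_fst (M : BlockMatrix H₁ H₂) (φ : AntiDual M.D) (z : M.D₁) :
    ⟪z, (M.shiftedInverse φ).fst⟫_ℂ =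
      φ (M.inl z) + ⟪M.repr₂₁ z, (riesz M.D₂).symm (antidualMap M.inr φ)⟫_ℂ := by
  have : (M.shiftedInverse φ).fst = (riesz M.D₁).symm (antidualMap M.inl φ +
      M.A₁₂ ((riesz M.D₂).symm (antidualMap M.inr φ))) + 0 := rfl
  rw [this, add_zero, inner_riesz_symm, add_apply, antidualMap_apply, A₁₂_apply]

lemma shiftedInverse_snd (M : BlockMatrix H₁ H₂) (φ : AntiDual M.D) :
    (M.shiftedInverse φ).snd = M.repr₂₁ (M.shiftedInverse φ).fst -
      (riesz M.D₂).symm (antidualMap M.inr φ) := by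
  have h1 : (M.shiftedInverse φ).fst = (riesz M.D₁).symm (antidualMap M.inl φ +
      M.A₁₂ ((riesz M.D₂).symm (antidualMap M.inr φ))) + 0 := rfl
  have : (M.shiftedInverse φ).snd = 0 + (M.repr₂₁ ((riesz M.D₁).symm (antidualMap M.inl φ +
      M.A₁₂ ((riesz M.D₂).symm (antidualMap M.inr φ)))) -
        (riesz M.D₂).symm (antidualMap M.inr φ)) := rfl
  rw [this, h1, zero_add, add_zero]

lemma shifted_shiftedInverse (M : BlockMatrix H₁ H₂) (φ : AntiDual M.D) :
    M.A (M.shiftedInverse φ) - rigDual M.I (M.shift (M.I (M.shiftedInverse φ))) = φ := by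
  ext z
  rw [shifted_apply, inner_shiftedInverse_fst, shiftedInverse_snd, sub_sub_cancel,
    add_sub_cancel_right, inner_riesz_symm, antidualMap_apply, ← map_add, inl_add_inr]

lemma shiftedInverse_shifted (M : BlockMatrix H₁ H₂) (y : M.D) :
    M.shiftedInverse (M.A y - rigDual M.I (M.shift (M.I y))) = y := by
  set φ := M.A y - rigDual M.I (M.shift (M.I y)) with hφ
  have h2 : (riesz M.D₂).symm (antidualMap M.inr φ) = M.repr₂₁ y.fst - y.snd := by
    refine ext_inner_left ℂ fun z => ?_
    rw [inner_riesz_symm, antidualMap_apply, hφ, shifted_apply]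
    simp
  have h1 : (M.shiftedInverse φ).fst = y.fst := by
    refine ext_inner_left ℂ fun z => ?_
    rw [inner_shiftedInverse_fst, h2, hφ, shifted_apply]
    simp
  rw [← M.inl_add_inr (M.shiftedInverse φ), shiftedInverse_snd, h1, h2, sub_sub_cancel,
    inl_add_inr]

lemma S_apply (M : BlockMatrix H₁ H₂) (z : ℂ) (x y : M.D₁) :
    M.S z x y = M.A₁₁ x y - z * ⟪M.I₁ y, M.I₁ x⟫_ℂ -
      M.A₁₂ ((M.pencil₂₂ z).inverse (M.A₂₁ x)) y := rfl

omit [CompleteSpace H₁] in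
lemma pencil₂₂_inverse (M : BlockMatrix H₁ H₂) {z : ℂ} (hz : z ∈ resolventSet M.friedrichs)
    (φ : AntiDual M.D₂) : M.pencil₂₂ z ((M.pencil₂₂ z).inverse φ) = φ := by
  obtain ⟨e, he⟩ := M.exists_equiv_pencil₂₂ hz
  rw [← he, ContinuousLinearMap.inverse_equiv]
  exact e.apply_symm_apply φ

/-- With `u_y` the solution of `(T₂₂ - t I₂*I₂)u_y = T₂₁y`, the last term of `S(t)` is the symmetric
form of this pencil evaluated at `u_y` and `u_z`. -/
lemma S_symm (M : BlockMatrix H₁ H₂) {t : ℝ} (ht : (t : ℂ) ∈ resolventSet M.friedrichs)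
    (y z : M.D₁) : M.S t y z = conj (M.S t z y) := by
  have key : ∀ y z, M.A₁₂ ((M.pencil₂₂ t).inverse (M.A₂₁ y)) z =
      conj (M.pencil₂₂ t ((M.pencil₂₂ t).inverse (M.A₂₁ z))
        ((M.pencil₂₂ t).inverse (M.A₂₁ y))) := fun y z => by
    rw [M.pencil₂₂_inverse ht, A₂₁_apply_eq_conj, Complex.conj_conj]
  rw [S_apply, S_apply, map_sub, map_sub, map_mul, ← A₁₁_symm, Complex.conj_ofReal,
    inner_conj_symm, key y z, key z y, ← pencil₂₂_symm, ← pencil₂₂_symm,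
    ← pencil₂₂_symm]

lemma continuousOn_S (M : BlockMatrix H₁ H₂) {s : Set ℝ}
    (hs : ∀ t ∈ s, (t : ℂ) ∈ resolventSet M.friedrichs) :
    ContinuousOn (fun t : ℝ => M.S t) s := by
  intro t ht
  obtain ⟨e, he⟩ := M.exists_equiv_pencil₂₂ (hs t ht)
  exact (ContinuousLinearMap.continuousAt_sub_comp_inverse_comp M.A₂₂ (rigDual M.I₂ ∘L M.I₂)
    M.A₁₁ (rigDual M.I₁ ∘L M.I₁) M.A₁₂ M.A₂₁ he).continuousWithinAt

/-- A left inverse of the pencil of the angular extension modulo compact operators yields one of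
the transfer function. -/
lemma exists_left_parametrix_S (M : BlockMatrix H₁ H₂) {t : ℝ}
    (hres : (t : ℂ) ∈ resolventSet M.friedrichs)
    (hspec : (t : ℂ) ∈ spectrum M.angularExtension →
      IsIsolatedFiniteEigenvalue M.angularExtension t) :
    ∃ (Q : AntiDual M.D₁ →L[ℂ] M.D₁) (k : M.D₁ →L[ℂ] M.D₁), IsCompactOperator k ∧
      Q ∘L M.S t = ContinuousLinearMap.id ℂ M.D₁ + k := by
  obtain ⟨Q, k, hk, hQ⟩ := exists_left_parametrix_pencil M.graph_angularExtension M.A_symm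
    M.shiftedInverse_shifted M.shifted_shiftedInverse hspec
  -- The second component is chosen to annihilate the second row of the pencil, leaving `(T - t
  -- I*I)V = p*S(t)` with `p*` the transpose of `p`. Since `pV = 1`, this gives `pQp*S(t) = p(1 +
  -- k)V = 1 + pkV`.
  let V : M.D₁ →L[ℂ] M.D := M.inl - M.inr ∘L (M.pencil₂₂ t).inverse ∘L M.A₂₁
  let p : M.D →L[ℂ] M.D₁ := WithLp.fstL 2 ℂ M.D₁ M.D₂
  have hV1 : ∀ y, (V y).fst = y := fun y => sub_zero y
  have hV2 : ∀ y, (V y).snd = -(M.pencil₂₂ t).inverse (M.A₂₁ y) := fun y => zero_sub _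
  have hSV : ∀ y, pencil M.I M.A t (V y) = antidualMap p (M.S t y) := fun y => by
    ext z
    have h1 : pencil M.I M.A t (V y) z = M.A (V y) z - (t : ℂ) *
      (⟪M.I₁ z.fst, M.I₁ (V y).fst⟫_ℂ + ⟪M.I₂ z.snd, M.I₂ (V y).snd⟫_ℂ) := rfl
    have h2 : M.pencil₂₂ t ((M.pencil₂₂ t).inverse (M.A₂₁ y)) z.snd = M.A₂₁ y z.snd := by
      rw [M.pencil₂₂_inverse hres]
    have h3 : ∀ u, M.pencil₂₂ t u z.snd = M.A₂₂ u z.snd - (t : ℂ) * ⟪M.I₂ z.snd, M.I₂ u⟫_ℂ :=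
      fun u => rfl
    rw [h3] at h2
    rw [h1, A_apply, hV1, hV2, ← h2, antidualMap_apply, show p z = z.fst from rfl, S_apply]
    simp only [map_neg, neg_apply, inner_neg_right]
    ring
  refine ⟨p ∘L Q ∘L antidualMap p, p ∘L k ∘L V, (hk.comp_clm V).clm_comp p, ?_⟩
  ext y
  have : Q (pencil M.I M.A t (V y)) = V y + k (V y) := DFunLike.congr_fun hQ (V y)
  change p (Q (antidualMap p (M.S t y))) = y + p (k (V y))
  rw [← hSV, this, map_add]
  exact congrArg (· + p (k (V y))) (hV1 y)

end BlockMatrix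
end BlockOp
end

theorem mainTheorem7 {H₁ H₂ : Type*}
    [NormedAddCommGroup H₁] [InnerProductSpace ℂ H₁] [CompleteSpace H₁]
    [NormedAddCommGroup H₂] [InnerProductSpace ℂ H₂] [CompleteSpace H₂]
    (M : BlockOp.BlockMatrix H₁ H₂) (ζm ζp : ℝ) (hζ : ζm ≤ ζp)
    (hres : ∀ t ∈ Set.Icc ζm ζp, (t : ℂ) ∈ BlockOp.resolventSet M.friedrichs)
    (hspec : ∀ t ∈ Set.Icc ζm ζp, (t : ℂ) ∈ BlockOp.spectrum M.angularExtension →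
      BlockOp.IsIsolatedFiniteEigenvalue M.angularExtension (t : ℂ)) :
    (BlockOp.IsCompactPerturbationOfPositive (M.S ζm) →
      BlockOp.IsCompactPerturbationOfPositive (M.S ζp)) ∧
    (BlockOp.IsCompactPerturbationOfNegative (M.S ζp) →
      BlockOp.IsCompactPerturbationOfNegative (M.S ζm)) := by
  have hcont := M.continuousOn_S hres
  have hm : ζm ∈ Set.Icc ζm ζp := Set.left_mem_Icc.2 hζ
  have hp : ζp ∈ Set.Icc ζm ζp := Set.right_mem_Icc.2 hζ
  constructor
  · exact BlockOp.IsCompactPerturbationOfPositive.along_curve (S := fun t : ℝ => M.S t) hcont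
      (fun t ht => M.S_symm (hres t ht))
      (fun t ht => M.exists_left_parametrix_S (hres t ht) (hspec t ht)) hm hp
  · exact BlockOp.IsCompactPerturbationOfNegative.along_curve (S := fun t : ℝ => M.S t) hcont
      (fun t ht => M.S_symm (hres t ht))
      (fun t ht => M.exists_left_parametrix_S (hres t ht) (hspec t ht)) hp hm
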